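/- \textbf{Cluster structure of the generalized negative binomial process.} Let $S$ be a measurable space that is countably separated (for instance a Polish space with its Borel sets), let $G_0$ be a finite, non-zero measure on $S$ without atoms, $\gamma_0:=G_0(S)$, let $a<1$, $0<p<1$ and $c:=(1-p)/p$. Expressions of the form $(x^a-y^a)/a$ are read at $a=0$ as their limit $\ln(x/y)$. \emph{The model.} For $\gamma\ge 0$, $\mathrm{gGamma}(\gamma,a,1/c)$ is the law on $[0,\infty)$ with Laplace transform $s\mapsto\exp(-\frac{\gamma}{a}[(c+s)^a-c^a])$, $s\ge 0$. Let $G=\sum_k r_k\delta_{\omega_k}$ ($r_k\ge0$, finitely or countably many atoms, a.s. distinct locations) be a generalized gamma process $\mathrm{gGaP}(G_0,a,c)$, i.e. an a.s. finite random measure whose values on disjoint measurable sets are independent, with $G(A)\sim\mathrm{gGamma}(G_0(A),a,1/c)$. Given $G$, let $m\sim\mathrm{Pois}(G(S))$, and given $G$ and $m$ let $z_1,\dots,z_m$ be i.i.d. with law $\sum_k \frac{r_k}{G(S)}\delta_k$ (nothing is drawn if $m=0$). The ties $z_i=z_j$ define a random partition $\Pi_m$ of $\{1,\dots,m\}$;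 its blocks are the clusters. For a partition $\pi$ of $\{1,\dots,n\}$ with $l$ blocks of sizes $n_1,\dots,n_l$ write $f(\pi,n):=P(m=n,\ \Pi_m=\pi)$. Put $$\lambda:=\gamma_0\frac{1-(1-p)^a}{a p^a},\qquad S_a(n,l):=\frac{n!}{l!}\sum_{\substack{n_1+\dots+n_l=n\\ n_k\ge 1}}\ \prod_{k=1}^l\frac{\Gamma(n_k-a)}{n_k!\,\Gamma(1-a)},$$ and let $\mathrm{TNB}(a,p)$ be the law on $\{1,2,\dots\}$ with mass function $\frac{\Gamma(u-a)}{u!\,\Gamma(-a)}\frac{p^u(1-p)^{-a}}{1-(1-p)^{-a}}$ (for $a=0$: $\frac{-1}{\ln(1-p)}\frac{p^u}{u}$). Let $\mathrm{gNB}(\gamma_0,a,p)$ be the law of $m\sim\mathrm{Pois}(\Lambda)$ with $\Lambda\sim\mathrm{gGamma}(\gamma_0,a,p/(1-p))$. \emph{Then:} (1) (ECPF) For every $n\ge 0$ and every partition $\pi$ of $\{1,\dots,n\}$, $$f(\pi,n)=\frac1{n!}\,e^{-\lambda}\,\gamma_0^{l}\,p^{\,n-al}\prod_{k=1}^l\frac{\Gamma(n_k-a)}{\Gamma(1-a)}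 .$$ (2) (EPPF) For every such $n$ and $\pi$, $$P(\Pi_m=\pi\mid m=n)=\frac{\gamma_0^{l}\,p^{-al}}{\sum_{j=0}^n\gamma_0^{j}p^{-aj}S_a(n,j)}\prod_{k=1}^l\frac{\Gamma(n_k-a)}{\Gamma(1-a)},$$ and if $a\ne 0$ the denominator is also the sum of the convergent series $$e^{\gamma_0/(ap^a)}\sum_{k=0}^\infty\frac1{k!}\Big(-\frac{\gamma_0}{ap^a}\Big)^k\frac{\Gamma(n-ak)}{\Gamma(-ak)},$$ where $\Gamma(n-ak)/\Gamma(-ak)$ denotes the rising factorial $\prod_{j=0}^{n-1}(j-ak)$. (3) (Cluster structure) For positive integers $n_1,\dots,n_l$ let $f(\{n_k\}_{1,l},n)$ be the probability that $m=n$, that there are exactly $l$ clusters, and that they have sizes $n_1,\dots,n_l$ when they are labelled $1,\dots,l$ uniformly at random. If $\sum_k n_k=n$, then for every partition $\pi$ of $\{1,\dots,n\}$ into blocks of these sizes, $$f(\{n_k\}_{1,l},n)=\frac1{l!}\,\frac{n!}{\prod_{k} n_k!}\,f(\pi,n)=\mathrm{Pois}(l;\lambda)\prod_{k=1}^l\mathrm{TNB}(n_k;a,p),$$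 and $f(\{n_k\}_{1,l},n)=0$ if $\sum_k n_k\ne n$. Equivalently, $\mathrm{TNB}(a,p)$ is a probability measure and the random multiset of cluster sizes has the law of $\{u_1,\dots,u_N\}$ with $N\sim\mathrm{Pois}(\lambda)$ and, given $N$, $u_1,\dots,u_N$ i.i.d. $\mathrm{TNB}(a,p)$. In particular the number of clusters is $\mathrm{Pois}(\lambda)$. (4) $m\sim\mathrm{gNB}(\gamma_0,a,p)$, with $$\mathbb E[t^m]=\exp\Big(-\gamma_0\frac{(1-pt)^a-(1-p)^a}{ap^a}\Big)\ (|t|\le 1),\qquad P(m=n)=\frac{p^n}{n!}e^{-\lambda}\sum_{l=0}^n\gamma_0^lp^{-al}S_a(n,l)\ (n\ge 0).$$ -/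

import Mathlib

open MeasureTheory ProbabilityTheory
open scoped NNReal ENNReal

/-! ### Generalized gamma process -/

/-- The Laplace exponent of the generalized gamma law with unit mass, discount `a` and rate `c`:
`((c + s)^a - c^a) / a`, read as its limit `log ((c + s) / c)` when `a = 0`. -/
noncomputable def genGammaExponent (a c s : ℝ) : ℝ :=
  if a = 0 then Real.log ((c + s) / c) else ((c + s) ^ a - c ^ a) / a

/-- `μ` is the generalized gamma distribution `gGamma(γ, a, θ)` (mass `γ`, discount `a`,
scale `θ = 1 / c`): the law on `[0, ∞)` with Laplace transform
`s ↦ exp (-γ ((c + s)^a - c^a) / a)`. -/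
structure IsGenGamma (μ : Measure ℝ) (γ a θ : ℝ) : Prop where
  isProbabilityMeasure : IsProbabilityMeasure μ
  nonneg : ∀ᵐ x ∂μ, 0 ≤ x
  laplace : ∀ s : ℝ, 0 ≤ s →
    ∫ x, Real.exp (-(s * x)) ∂μ = Real.exp (-(γ * genGammaExponent a θ⁻¹ s))

/-- `G` is a generalized gamma process `gGaP(G₀, a, c)` on `S`: an a.s. finite random measure that
assigns independent masses `G(A) ∼ gGamma(G₀(A), a, 1 / c)` to disjoint measurable sets. -/
structure IsGenGammaProcess {Ω S : Type*} [MeasurableSpace Ω] [MeasurableSpace S]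
    (P : Measure Ω) (G : Ω → Measure S) (G₀ : Measure S) (a c : ℝ) : Prop where
  measurable : Measurable G
  finite : ∀ᵐ ω ∂P, G ω Set.univ < ∞
  indep : ∀ (n : ℕ) (A : Fin n → Set S), (∀ i, MeasurableSet (A i)) →
    Pairwise (fun i j => Disjoint (A i) (A j)) → iIndepFun (fun i ω => G ω (A i)) P
  law : ∀ A : Set S, MeasurableSet A →
    IsGenGamma (P.map fun ω => (G ω).real A) (G₀.real A) a c⁻¹

/-! ### Count-mixture model -/

/-- The random measure `∑ₖ wₖ δ_{xₖ}` with weights `wₖ ≥ 0` and atom locations `xₖ`. A finite number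
`K` of atoms is the case `wₖ = 0` for `k ≥ K`. -/
noncomputable def atomicMeasure {Ω S : Type*} [MeasurableSpace S]
    (w : ℕ → Ω → ℝ≥0) (x : ℕ → Ω → S) (ω : Ω) : Measure S :=
  Measure.sum fun k => (w k ω : ℝ≥0∞) • Measure.dirac (x k ω)

/-- The σ-algebra generated by the weights and the locations of all atoms. -/
abbrev atomSigma {Ω S : Type*} [MeasurableSpace S]
    (w : ℕ → Ω → ℝ≥0) (x : ℕ → Ω → S) : MeasurableSpace Ω :=
  ⨆ k, (MeasurableSpace.comap (w k) inferInstance ⊔ MeasurableSpace.comap (x k) inferInstance)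

/-- The count-mixture model driven by `G = ∑ₖ wₖ δ_{xₖ}`, with distinct atoms: given `G`, the sample
size is `m ∼ Pois(G(S))`, and given `G` and `m` the atom indices `z₀, …, z_{m-1}` of the data points
are independent with law `∑ₖ (wₖ / G(S)) δₖ`. The values `zᵢ` with `i ≥ m` play no role. -/
structure IsCountMixture {Ω S : Type*} [MeasurableSpace Ω] [MeasurableSpace S]
    (P : Measure Ω) (w : ℕ → Ω → ℝ≥0) (x : ℕ → Ω → S) (m : Ω → ℕ) (z : ℕ → Ω → ℕ) : Prop where
  measurable_weight : ∀ k, Measurable (w k)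
  measurable_loc : ∀ k, Measurable (x k)
  measurable_size : Measurable m
  measurable_index : ∀ i, Measurable (z i)
  distinct : ∀ᵐ ω ∂P, ∀ j k, w j ω ≠ 0 → w k ω ≠ 0 → x j ω = x k ω → j = k
  condLaw : ∀ (n : ℕ) (k : Fin n → ℕ),
    P⟦{ω | m ω = n ∧ ∀ i : Fin n, z i ω = k i} | atomSigma w x⟧ =ᵐ[P] fun ω =>
      (Real.exp (-(atomicMeasure w x ω).real Set.univ) *
          (atomicMeasure w x ω).real Set.univ ^ n / (n.factorial : ℝ)) *
        ∏ i, ((w (k i) ω : ℝ) / (atomicMeasure w x ω).real Set.univ)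

/-! ### The random partition and the clusters -/

/-- The partition of `{0, …, n-1}` given by the ties `z i = z j`. -/
def tiePartition {n : ℕ} {β : Type*} [DecidableEq β] (z : Fin n → β) :
    Finpartition (Finset.univ : Finset (Fin n)) :=
  letI : DecidableRel (Setoid.ker z).r := fun i j => decEq (z i) (z j)
  Finpartition.ofSetoid (Setoid.ker z)

/-- The event that the sample size is `n` and the partition of the sample is `π`. -/
def clusterEvent {Ω : Type*} (m : Ω → ℕ) (z : ℕ → Ω → ℕ) {n : ℕ}
    (π : Finpartition (Finset.univ : Finset (Fin n))) : Set Ω :=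
  {ω | m ω = n ∧ tiePartition (fun i : Fin n => z i ω) = π}

/-- The number of clusters in the sample. -/
def numClusters {Ω : Type*} (m : Ω → ℕ) (z : ℕ → Ω → ℕ) (ω : Ω) : ℕ :=
  (tiePartition (fun i : Fin (m ω) => z i ω)).parts.card

/-- The multiset of the sizes of the clusters in the sample. -/
def clusterSizes {Ω : Type*} (m : Ω → ℕ) (z : ℕ → Ω → ℕ) (ω : Ω) : Multiset ℕ :=
  (tiePartition (fun i : Fin (m ω) => z i ω)).parts.val.map Finset.card

/-- The labellings of `n` data points by `l` labels in which label `k` is used `u k` times. -/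
def labellings (n l : ℕ) (u : Fin l → ℕ) : Finset (Fin n → Fin l) :=
  Finset.univ.filter fun c => ∀ k, (Finset.univ.filter fun i => c i = k).card = u k

/-- The probability `f({n₁, …, n_l}, n)` that the sample has size `n` and `l` clusters which, when
labelled `1, …, l` uniformly at random, have sizes `u 1, …, u l`. -/
noncomputable def sizesProb {Ω : Type*} [MeasurableSpace Ω] (P : Measure Ω)
    (m : Ω → ℕ) (z : ℕ → Ω → ℕ) (n l : ℕ) (u : Fin l → ℕ) : ℝ :=
  (1 / (l.factorial : ℝ)) *
    ∑ c ∈ labellings n l u, P.real (clusterEvent m z (tiePartition c))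

/-! ### Distributions on the natural numbers -/

/-- `(1 - (1 - p)^a) / (a p^a)`, read as its limit `-log (1 - p)` when `a = 0`. -/
noncomputable def clusterRate (a p : ℝ) : ℝ :=
  if a = 0 then -Real.log (1 - p) else (1 - (1 - p) ^ a) / (a * p ^ a)

/-- The probability mass function of the truncated negative binomial law `TNB(a, p)` on
`{1, 2, …}`; for `a = 0` it is the logarithmic law. -/
noncomputable def tnbPMFReal (a p : ℝ) (u : ℕ) : ℝ :=
  if u = 0 then 0
  else if a = 0 then -1 / Real.log (1 - p) * (p ^ u / (u : ℝ))
  else Real.Gamma (u - a) / ((u.factorial : ℝ) * Real.Gamma (-a)) *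
    (p ^ u * (1 - p) ^ (-a) / (1 - (1 - p) ^ (-a)))

/-- The truncated negative binomial law `TNB(a, p)`. -/
noncomputable def tnbMeasure (a p : ℝ) : Measure ℕ :=
  Measure.sum fun u => ENNReal.ofReal (tnbPMFReal a p u) • Measure.dirac u

/-- `μ` is the generalized negative binomial law `gNB(γ, a, p)`: the law of `m ∼ Pois(λ)` with
`λ ∼ gGamma(γ, a, p / (1 - p))`. -/
def IsGenNegBinomial (μ : Measure ℕ) (γ a p : ℝ) : Prop :=
  ∃ ν : Measure ℝ, IsGenGamma ν γ a (p / (1 - p)) ∧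
    μ = ν.bind fun t => poissonMeasure t.toNNReal

/-- `((1 - p t)^a - (1 - p)^a) / (a p^a)`, read as its limit `log ((1 - p t) / (1 - p))` when
`a = 0`. -/
noncomputable def gnbExponent (a p t : ℝ) : ℝ :=
  if a = 0 then Real.log ((1 - p * t) / (1 - p))
  else ((1 - p * t) ^ a - (1 - p) ^ a) / (a * p ^ a)

instance instMeasurableSpaceMultisetNat : MeasurableSpace (Multiset ℕ) := ⊤

/-- The law of the multiset `{u₁, …, u_N}` where `N ∼ Pois(r)` and, given `N`, the `uₖ` are
independent with law `τ`. -/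
noncomputable def compoundSizesLaw (r : ℝ≥0) (τ : Measure ℕ) : Measure (Multiset ℕ) :=
  (poissonMeasure r).bind fun l =>
    (Measure.pi fun _ : Fin l => τ).map fun u => (Finset.univ : Finset (Fin l)).val.map u

/-! ### Generalized Stirling numbers -/

/-- The generalized Stirling number of the first kind
`S_a(m, l) = (m! / l!) ∑ ∏ₖ Γ(nₖ - a) / (nₖ! Γ(1 - a))`, the sum being over all `l`-tuples of
positive integers with `n₁ + ⋯ + n_l = m`. -/
noncomputable def genStirling (a : ℝ) (m l : ℕ) : ℝ :=
  (m.factorial : ℝ) / (l.factorial : ℝ) *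
    ∑ n ∈ (Finset.piAntidiag (Finset.univ : Finset (Fin l)) m).filter (fun n => ∀ k, 0 < n k),
      ∏ k, Real.Gamma ((n k : ℝ) - a) / (((n k).factorial : ℝ) * Real.Gamma (1 - a))

/-- `∑_{l=0}^m γ^l p^{-al} S_a(m, l)`. -/
noncomputable def eppfNormalizer (γ a p : ℝ) (m : ℕ) : ℝ :=
  ∑ l ∈ Finset.range (m + 1), γ ^ l * p ^ (-(a * l)) * genStirling a m l

/-! ### Partitions by ties -/

/-! Everything rests on the ECPF, proved in `measure_clusterEvent` by discretizing `S`. Given `G`,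
with total mass `T`, the event that `m = n` and the indices are `k` has probability `e^{-T} / n! * ∏
w_{k i}`: the power of `T` in the Poisson weight cancels the normalization of the draws. So the
probability of a partition `π` is the mean of `e^{-T} / n!` times the mass that the product measure
with these weights gives to the tuples with ties `π`.

Countable separation supplies an injective measurable map into bit sequences; its first `N` bits cut
`S` into finitely many cells. The atoms are distinct, so for large `N` the ties of the indices are
the ties of the cells, and the mass is a limit of finite sums of products of cell masses
(`tendsto_pi_indexMeasure_cell`, `pi_indexMeasure_cell`). For fixed `N`, independence splits the
expectation into moments `E[G(A)^k e^{-G(A)}]`. Differentiating the Laplace transform evaluates them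
as an exponential times a polynomial `blockPoly` in `G₀(A)`, whose coefficients obey a triangular
recurrence. The exponentials multiply to `e^{-λ}`; what remains is a sum, over injections of the
blocks into the cells, of a product of polynomials.

As `G₀` has no atoms, the sum of the squared cell masses tends to `0` (`tendsto_sum_cell_sq`). Hence
only the linear coefficient `p^{k-a} Γ(k-a) / Γ(1-a)` of each polynomial survives and non-injective
maps are negligible (`tendsto_sum_embedding`). Each block contributes `γ₀` times this coefficient,
which is the ECPF.

The rest is summation. Adding over the partitions of `n` points gives `P(m = n)`, and dividing by it
gives the EPPF. The moments of `G(S)` give `P(m = n)` a second time; comparing the two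
(`eppfNormalizer_eq`) turns the normalizer into a polynomial with the triangular coefficients, for
which the series follows from an expansion of rising factorials in falling ones. Since the ECPF
depends only on block sizes, counting labellings by multinomial coefficients rewrites it as Poisson
times i.i.d. TNB weights, and comparison on singletons gives the law of the multiset of sizes. The
generating function of `m` is the Laplace transform of `G(S)` at `1 - t`. -/

lemma mem_part_tiePartition {n : ℕ} {β : Type*} [DecidableEq β] (z : Fin n → β) (i j : Fin n) :
    i ∈ (tiePartition z).part j ↔ z j = z i := by
  let _ : DecidableRel (Setoid.ker z).r := fun i j => decEq (z i) (z j)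
  exact Finpartition.mem_part_ofSetoid_iff_rel (s := Setoid.ker z)

lemma part_tiePartition_eq_iff {n : ℕ} {β : Type*} [DecidableEq β] (z : Fin n → β) (i j : Fin n) :
    (tiePartition z).part i = (tiePartition z).part j ↔ z i = z j := by
  rw [← Finpartition.mem_part_iff_part_eq_part _ (Finset.mem_univ _) (Finset.mem_univ _),
    mem_part_tiePartition, eq_comm]

lemma Finpartition.parts_eq_image_part {n : ℕ}
    (π : Finpartition (Finset.univ : Finset (Fin n))) : π.parts = Finset.univ.image π.part := by
  ext B
  simp only [Finset.mem_image, Finset.mem_univ, true_and]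
  constructor
  · intro hB
    obtain ⟨i, hi⟩ := π.nonempty_of_mem_parts hB
    exact ⟨i, π.part_eq_of_mem hB hi⟩
  · rintro ⟨i, rfl⟩
    exact π.part_mem.2 (Finset.mem_univ i)

lemma tiePartition_eq_iff {n : ℕ} {β : Type*} [DecidableEq β] (z : Fin n → β)
    (π : Finpartition (Finset.univ : Finset (Fin n))) :
    tiePartition z = π ↔ ∀ i j, z i = z j ↔ π.part i = π.part j := by
  constructor
  · rintro rfl i j
    exact (part_tiePartition_eq_iff z i j).symm
  · intro h
    have hp : (tiePartition z).part = π.part := by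
      funext j
      ext i
      rw [mem_part_tiePartition, h,
        Finpartition.mem_part_iff_part_eq_part _ (Finset.mem_univ _) (Finset.mem_univ _), eq_comm]
    apply Finpartition.ext
    rw [Finpartition.parts_eq_image_part, Finpartition.parts_eq_image_part π, hp]

lemma tiePartition_congr {n : ℕ} {β δ : Type*} [DecidableEq β] [DecidableEq δ] {z : Fin n → β}
    {y : Fin n → δ} (h : ∀ i j, z i = z j ↔ y i = y j) : tiePartition z = tiePartition y := by
  rw [tiePartition_eq_iff]
  intro i j
  rw [part_tiePartition_eq_iff, h]

/-- The block of a data point. -/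
def Finpartition.toBlock {n : ℕ} (π : Finpartition (Finset.univ : Finset (Fin n))) (i : Fin n) :
    π.parts :=
  ⟨π.part i, π.part_mem.2 (Finset.mem_univ i)⟩

lemma Finpartition.toBlock_surjective {n : ℕ}
    (π : Finpartition (Finset.univ : Finset (Fin n))) : Function.Surjective π.toBlock := by
  rintro ⟨B, hB⟩
  obtain ⟨i, hi⟩ := π.nonempty_of_mem_parts hB
  exact ⟨i, Subtype.ext (π.part_eq_of_mem hB hi)⟩

lemma Finpartition.filter_toBlock {n : ℕ} (π : Finpartition (Finset.univ : Finset (Fin n)))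
    (B : π.parts) : (Finset.univ.filter fun i => π.toBlock i = B) = B.1 := by
  ext i
  simp only [Finset.mem_filter, Finset.mem_univ, true_and]
  rw [← π.part_eq_iff_mem B.2, Subtype.ext_iff]
  rfl

lemma tiePartition_comp_toBlock {n : ℕ} {β : Type*} [DecidableEq β]
    (π : Finpartition (Finset.univ : Finset (Fin n))) (σ : π.parts ↪ β) :
    tiePartition (fun i => σ (π.toBlock i)) = π := by
  rw [tiePartition_eq_iff]
  intro i j
  rw [σ.injective.eq_iff, Subtype.ext_iff]
  rfl

/-- A map whose ties are exactly `π` is constant on blocks and separates them, so it factors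
uniquely through an injection of the blocks. This serves both for cells of `S` and, with `F = 1`,
for counting labellings. -/
lemma sum_filter_tiePartition_eq {n : ℕ} {ι M : Type*} [Fintype ι] [DecidableEq ι]
    [AddCommMonoid M] (π : Finpartition (Finset.univ : Finset (Fin n))) (F : (Fin n → ι) → M) :
    ∑ κ ∈ Finset.univ.filter (fun κ : Fin n → ι => tiePartition κ = π), F κ =
      ∑ σ : π.parts ↪ ι, F fun i => σ (π.toBlock i) := by
  symm
  refine Finset.sum_bij (fun σ _ i => σ (π.toBlock i)) ?_ ?_ ?_ ?_
  · intro σ _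
    simpa using tiePartition_comp_toBlock π σ
  · intro σ _ τ _ h
    ext B
    obtain ⟨i, rfl⟩ := π.toBlock_surjective B
    exact congrFun h i
  · intro κ hκ
    have hκ' := (tiePartition_eq_iff κ π).1 (Finset.mem_filter.1 hκ).2
    choose r hr using π.toBlock_surjective
    refine ⟨⟨fun B => κ (r B), fun B C h => ?_⟩, Finset.mem_univ _, ?_⟩
    · rw [← hr B, ← hr C]
      exact Subtype.ext ((hκ' _ _).1 h)
    · funext i
      exact (hκ' _ _).2 (congrArg Subtype.val (hr (π.toBlock i)))
  · intros
    rfl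

lemma card_filter_tiePartition_eq {n : ℕ} (π : Finpartition (Finset.univ : Finset (Fin n))) :
    (Finset.univ.filter fun c : Fin n → Fin π.parts.card => tiePartition c = π).card =
      π.parts.card.factorial := by
  rw [Finset.card_eq_sum_ones, sum_filter_tiePartition_eq]
  simp [Fintype.card_embedding_eq, Nat.descFactorial_self]

lemma tiePartition_card_parts {n : ℕ} {ι : Type*} [Fintype ι] [DecidableEq ι] {c : Fin n → ι}
    (hc : Function.Surjective c) : (tiePartition c).parts.card = Fintype.card ι := by
  have h := fun i j => part_tiePartition_eq_iff c i j
  choose r hr using hc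
  symm
  rw [← Finset.card_univ]
  refine Finset.card_bij (fun k _ => (tiePartition c).part (r k)) ?_ ?_ ?_
  · intro k _
    exact (tiePartition c).part_mem.2 (Finset.mem_univ _)
  · intro k _ k' _ hk
    rw [h, hr, hr] at hk
    exact hk
  · intro B hB
    rw [Finpartition.parts_eq_image_part] at hB
    obtain ⟨i, -, rfl⟩ := Finset.mem_image.1 hB
    exact ⟨c i, Finset.mem_univ _, (h _ _).2 (hr _)⟩

lemma surjective_of_card_parts {n : ℕ} {ι : Type*} [Fintype ι] [DecidableEq ι] {c : Fin n → ι}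
    (hc : (tiePartition c).parts.card = Fintype.card ι) : Function.Surjective c := by
  set π := tiePartition c with hπ
  have h1 := (Finset.mem_filter (p := fun κ : Fin n → ι => tiePartition κ = π)
    (s := Finset.univ)).2 ⟨Finset.mem_univ c, hπ.symm⟩
  have h : ∀ i j, c i = c j ↔ π.part i = π.part j := (tiePartition_eq_iff c π).1 hπ.symm
  choose r hr using π.toBlock_surjective
  have hinj : Function.Injective fun B => c (r B) := fun B C hBC => by
    rw [← hr B, ← hr C]
    exact Subtype.ext ((h _ _).1 hBC)
  have hcard : Fintype.card π.parts = Fintype.card ι := by simpa using hc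
  have hb := (Fintype.bijective_iff_injective_and_card _).2 ⟨hinj, hcard⟩
  intro k
  obtain ⟨B, hB⟩ := hb.2 k
  exact ⟨r B, hB⟩

lemma map_card_parts_tiePartition {n : ℕ} {ι : Type*} [Fintype ι] [DecidableEq ι] {c : Fin n → ι}
    (hc : Function.Surjective c) :
    (tiePartition c).parts.val.map Finset.card =
      (Finset.univ : Finset ι).val.map fun k => (Finset.univ.filter fun i => c i = k).card := by
  choose r hr using hc
  have hparts : (tiePartition c).parts =
      (Finset.univ : Finset ι).map ⟨fun k => Finset.univ.filter fun i => c i = k, fun k k' h => by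
        have : r k ∈ Finset.univ.filter fun i => c i = k := by simp [hr]
        simp only at h
        rw [h] at this
        simpa [hr] using this⟩ := by
    rw [Finpartition.parts_eq_image_part]
    ext B
    simp only [Finset.mem_image, Finset.mem_univ, true_and, Finset.mem_map]
    have hpart : ∀ i, (tiePartition c).part i = Finset.univ.filter fun j => c j = c i := by
      intro i
      ext j
      simp [mem_part_tiePartition, eq_comm]
    constructor
    · rintro ⟨i, rfl⟩
      exact ⟨c i, (hpart i).symm⟩
    · rintro ⟨k, rfl⟩
      exact ⟨r k, by rw [hpart, hr]; rfl⟩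
  rw [hparts, Finset.map_val, Multiset.map_map]
  rfl

lemma prod_parts_tiePartition {n : ℕ} {ι : Type*} [Fintype ι] [DecidableEq ι] {c : Fin n → ι}
    (hc : Function.Surjective c) (f : ℕ → ℝ) :
    ∏ B ∈ (tiePartition c).parts, f B.card =
      ∏ k, f (Finset.univ.filter fun i => c i = k).card := by
  have h := congrArg (fun s => (Multiset.map f s).prod) (map_card_parts_tiePartition hc)
  rw [Multiset.map_map, Multiset.map_map] at h
  exact h

/-- A partition into `l` blocks has `l!` labellings, all of them surjective; this converts sums over
partitions into sums over labellings. -/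
lemma sum_surjective_tiePartition {n l : ℕ}
    (h : Finpartition (Finset.univ : Finset (Fin n)) → ℝ) :
    ∑ c : Fin n → Fin l with Function.Surjective c, h (tiePartition c) =
      l.factorial * ∑ π : Finpartition (Finset.univ : Finset (Fin n)) with π.parts.card = l,
        h π := by
  rw [Finset.mul_sum]
  rw [← Finset.sum_fiberwise_of_maps_to (s := Finset.univ.filter fun c : Fin n → Fin l =>
    Function.Surjective c) (t := Finset.univ.filter fun
      π : Finpartition (Finset.univ : Finset (Fin n)) => π.parts.card = l) (g := tiePartition)]
  · refine Finset.sum_congr rfl fun π hπ => ?_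
    obtain rfl := (Finset.mem_filter.1 hπ).2
    rw [Finset.filter_filter, ← card_filter_tiePartition_eq, ← nsmul_eq_mul, ← Finset.sum_const]
    have : (Finset.univ.filter fun c : Fin n → Fin π.parts.card =>
        Function.Surjective c ∧ tiePartition c = π) =
        Finset.univ.filter fun c => tiePartition c = π := by
      refine Finset.filter_congr fun c _ => and_iff_right_of_imp fun hc => ?_
      apply surjective_of_card_parts
      rw [hc, Fintype.card_fin]
    rw [this]
    exact Finset.sum_congr rfl fun c hc => by rw [(Finset.mem_filter.1 hc).2]
  · intro c hc
    have := tiePartition_card_parts (Finset.mem_filter.1 hc).2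
    simpa using this

/-! ### Labellings with prescribed class sizes. -/

lemma labellings_sum_eq {n l : ℕ} {u : Fin l → ℕ} {c : Fin n → Fin l}
    (hc : c ∈ labellings n l u) : ∑ k, u k = n := by
  have h := (Finset.mem_filter.1 hc).2
  have := Finset.card_eq_sum_card_fiberwise (s := (Finset.univ : Finset (Fin n)))
    (t := (Finset.univ : Finset (Fin l))) (f := c) (fun _ _ => Finset.mem_univ _)
  rw [← Finset.sum_congr rfl fun k _ => h k, ← this, Finset.card_univ, Fintype.card_fin]

lemma labellings_surjective {n l : ℕ} {u : Fin l → ℕ} (hu : ∀ k, 0 < u k) {c : Fin n → Fin l}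
    (hc : c ∈ labellings n l u) : Function.Surjective c := by
  intro k
  have h := (Finset.mem_filter.1 hc).2 k
  obtain ⟨i, hi⟩ := Finset.card_pos.1 (h ▸ hu k)
  exact ⟨i, (Finset.mem_filter.1 hi).2⟩

/-- Compare the coefficients of `X^u` in `(∑ X_k)^n`, expanded once by the multinomial theorem and
once by distributing the product over all maps `Fin n → Fin l`. -/
lemma card_labellings {n l : ℕ} {u : Fin l → ℕ} (hu : ∑ k, u k = n) :
    (labellings n l u).card = Nat.multinomial Finset.univ u := by
  have h := Finset.sum_pow_eq_sum_piAntidiag (Finset.univ : Finset (Fin l))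
    (fun k => (MvPolynomial.X k : MvPolynomial (Fin l) ℕ)) n
  have h2 : (∑ k : Fin l, (MvPolynomial.X k : MvPolynomial (Fin l) ℕ)) ^ n =
      ∑ c : Fin n → Fin l, MvPolynomial.monomial
        (Finsupp.equivFunOnFinite.symm fun k => (Finset.univ.filter fun i => c i = k).card) 1 := by
    rw [← Fin.prod_const n, Finset.prod_univ_sum]
    simp only [Fintype.piFinset_univ]
    refine Finset.sum_congr rfl fun c _ => ?_
    rw [MvPolynomial.monomial_eq]
    simp only [map_one, one_mul]
    rw [Finsupp.prod_fintype _ _ (by simp)]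
    simp only [Finsupp.equivFunOnFinite_symm_apply_apply]
    rw [← Finset.prod_fiberwise_of_maps_to (s := Finset.univ) (t := Finset.univ) (g := c)
      (fun _ _ => Finset.mem_univ _)]
    refine Finset.prod_congr rfl fun k _ => ?_
    rw [Finset.prod_congr rfl fun i hi => by rw [(Finset.mem_filter.1 hi).2], Finset.prod_const]
  have h3 : ∀ v : Fin l → ℕ, (∏ k, (MvPolynomial.X k : MvPolynomial (Fin l) ℕ) ^ v k) =
      MvPolynomial.monomial (Finsupp.equivFunOnFinite.symm v) 1 := by
    intro v
    rw [MvPolynomial.monomial_eq, Finsupp.prod_fintype _ _ (by simp)]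
    simp
  rw [h2] at h
  have h4 := congrArg (MvPolynomial.coeff (Finsupp.equivFunOnFinite.symm u)) h
  simp only [h3, MvPolynomial.coeff_sum, MvPolynomial.coeff_monomial,
    EmbeddingLike.apply_eq_iff_eq, ← MvPolynomial.C_eq_coe_nat,
    MvPolynomial.coeff_C_mul] at h4
  rw [labellings, Finset.card_filter]
  simp only [mul_ite, mul_one, mul_zero, Finset.sum_ite_eq', Finset.mem_piAntidiag] at h4
  rw [if_pos ⟨hu, fun k _ => Finset.mem_univ k⟩] at h4
  simpa [funext_iff] using h4

lemma card_labellings_real {n l : ℕ} {u : Fin l → ℕ} (hu : ∑ k, u k = n) :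
    ((labellings n l u).card : ℝ) = (n.factorial : ℝ) / ∏ k, ((u k).factorial : ℝ) := by
  have h := Nat.multinomial_spec (Finset.univ : Finset (Fin l)) u
  rw [hu] at h
  rw [card_labellings hu, eq_div_iff (Finset.prod_ne_zero_iff.2 fun k _ => by positivity), ← h]
  push_cast
  ring

/-- Sum over surjections `Fin n → Fin l` in two ways: by tie partition each fibre has `l!` elements,
by class sizes it has a multinomial number. -/
lemma sum_parts_card_eq {n l : ℕ} (f : ℕ → ℝ) :
    ∑ π : Finpartition (Finset.univ : Finset (Fin n)) with π.parts.card = l,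
        ∏ B ∈ π.parts, f B.card =
      (n.factorial : ℝ) / (l.factorial : ℝ) *
        ∑ u ∈ (Finset.piAntidiag (Finset.univ : Finset (Fin l)) n).filter (fun u => ∀ k, 0 < u k),
          ∏ k, f (u k) / ((u k).factorial : ℝ) := by
  have h := sum_surjective_tiePartition (n := n) (l := l) fun π => ∏ B ∈ π.parts, f B.card
  have hl : (l.factorial : ℝ) ≠ 0 := by positivity
  rw [div_mul_eq_mul_div, eq_div_iff hl, mul_comm, ← h, Finset.mul_sum,
    ← Finset.sum_fiberwise_of_maps_to (s := Finset.univ.filter fun c : Fin n → Fin l =>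
      Function.Surjective c) (g := fun c k => (Finset.univ.filter fun i => c i = k).card)
      (t := (Finset.piAntidiag (Finset.univ : Finset (Fin l)) n).filter fun u => ∀ k, 0 < u k)]
  · refine Finset.sum_congr rfl fun u hu => ?_
    obtain ⟨hu1, hu2⟩ := Finset.mem_filter.1 hu
    have hsum := (Finset.mem_piAntidiag.1 hu1).1
    rw [Finset.prod_div_distrib, mul_div_assoc', mul_div_right_comm, ← card_labellings_real hsum,
      ← nsmul_eq_mul, ← Finset.sum_const, Finset.filter_filter]
    have : (Finset.univ.filter fun c : Fin n → Fin l => Function.Surjective c ∧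
        (fun k => (Finset.univ.filter fun i => c i = k).card) = u) = labellings n l u := by
      ext c
      simp only [Finset.mem_filter, Finset.mem_univ, true_and]
      constructor
      · rintro ⟨-, rfl⟩
        simp [labellings]
      · intro hc
        exact ⟨labellings_surjective hu2 hc, funext (Finset.mem_filter.1 hc).2⟩
    rw [this]
    refine Finset.sum_congr rfl fun c hc => ?_
    rw [prod_parts_tiePartition (labellings_surjective hu2 hc)]
    exact Finset.prod_congr rfl fun k _ => by rw [(Finset.mem_filter.1 hc).2 k]
  · intro c hc
    have hc := (Finset.mem_filter.1 hc).2
    have hm : c ∈ labellings n l fun k => (Finset.univ.filter fun i => c i = k).card := by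
      simp [labellings]
    rw [Finset.mem_filter, Finset.mem_piAntidiag]
    refine ⟨⟨labellings_sum_eq hm, fun k _ => Finset.mem_univ k⟩, fun k => ?_⟩
    obtain ⟨i, hi⟩ := hc k
    exact Finset.card_pos.2 ⟨i, by simpa using hi⟩

/-! ### Moments of the generalized gamma law -/

/-- The triangular array with `T (n + 1) (l + 1) = T n l + (n - a (l + 1)) T n (l + 1)`. -/
def stirlingTriangle (a : ℝ) : ℕ → ℕ → ℝ
  | 0, 0 => 1
  | 0, _ + 1 => 0
  | n + 1, 0 => n * stirlingTriangle a n 0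
  | n + 1, l + 1 => stirlingTriangle a n l + (n - a * (l + 1)) * stirlingTriangle a n (l + 1)

lemma stirlingTriangle_eq_zero (a : ℝ) {n l : ℕ} (h : n < l) : stirlingTriangle a n l = 0 := by
  induction n generalizing l with
  | zero =>
    obtain ⟨l, rfl⟩ := Nat.exists_eq_succ_of_ne_zero (by omega : l ≠ 0)
    rfl
  | succ n ih =>
    obtain ⟨l, rfl⟩ := Nat.exists_eq_succ_of_ne_zero (by omega : l ≠ 0)
    simp only [stirlingTriangle]
    rw [ih (by omega), ih (by omega)]
    ring

lemma stirlingTriangle_succ_zero (a : ℝ) (n : ℕ) : stirlingTriangle a (n + 1) 0 = 0 := by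
  induction n with
  | zero => simp [stirlingTriangle]
  | succ n ih => rw [stirlingTriangle, ih, mul_zero]

/-- The recurrence of the triangle, tested against an arbitrary `f`. It drives both inductions that
produce these coefficients: for the moments and for the rising factorials. -/
lemma sum_stirlingTriangle_succ (a : ℝ) (n : ℕ) (f : ℕ → ℝ) :
    ∑ l ∈ Finset.range (n + 2), f l * stirlingTriangle a (n + 1) l =
      ∑ l ∈ Finset.range (n + 1), f (l + 1) * stirlingTriangle a n l +
        ∑ l ∈ Finset.range (n + 1), f l * ((n - a * l) * stirlingTriangle a n l) := by
  rw [Finset.sum_range_succ', Finset.sum_range_succ'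
    (fun l => f l * ((n - a * l) * stirlingTriangle a n l))]
  -- The top term may be dropped because it contains `T(n, n + 1) = 0`.
  have h : ∑ l ∈ Finset.range (n + 1), f (l + 1) * ((n - a * ((l : ℝ) + 1)) *
      stirlingTriangle a n (l + 1)) = ∑ l ∈ Finset.range n, f (l + 1) * ((n - a * ((l : ℝ) + 1)) *
      stirlingTriangle a n (l + 1)) := by
    rw [Finset.sum_range_succ, stirlingTriangle_eq_zero a (Nat.lt_succ_self n)]
    simp
  push_cast
  rw [← h, ← add_assoc, ← Finset.sum_add_distrib]
  congr 1
  · refine Finset.sum_congr rfl fun l _ => ?_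
    rw [stirlingTriangle]
    ring
  · rw [stirlingTriangle]
    ring

/-- The weight `Γ(n - a) / Γ(1 - a)` of a block of size `n`. -/
noncomputable def blockWeight (a : ℝ) (n : ℕ) : ℝ :=
  Real.Gamma ((n : ℝ) - a) / Real.Gamma (1 - a)

lemma blockWeight_one {a : ℝ} (ha : a < 1) : blockWeight a 1 = 1 := by
  simp [blockWeight, div_self (Real.Gamma_pos_of_pos (sub_pos.2 ha)).ne']

lemma blockWeight_succ {a : ℝ} (ha : a < 1) {n : ℕ} (hn : 0 < n) :
    blockWeight a (n + 1) = (n - a) * blockWeight a n := by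
  have h : (n : ℝ) - a ≠ 0 := by
    have : (1 : ℝ) ≤ n := by exact_mod_cast hn
    linarith
  rw [blockWeight, blockWeight, mul_div_assoc', ← Real.Gamma_add_one h]
  congr 2
  push_cast
  ring

lemma blockWeight_pos {a : ℝ} (ha : a < 1) {n : ℕ} (hn : 0 < n) : 0 < blockWeight a n := by
  have : (1 : ℝ) ≤ n := by exact_mod_cast hn
  exact div_pos (Real.Gamma_pos_of_pos (by linarith)) (Real.Gamma_pos_of_pos (by linarith))

lemma stirlingTriangle_one {a : ℝ} (ha : a < 1) (n : ℕ) :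
    stirlingTriangle a (n + 1) 1 = blockWeight a (n + 1) := by
  induction n with
  | zero => simp [stirlingTriangle, blockWeight_one ha]
  | succ n ih =>
    rw [stirlingTriangle, blockWeight_succ ha n.succ_pos, ← ih, stirlingTriangle_succ_zero]
    simp

/-- The derivative has the same form for `a = 0`, so the moment computation needs no case
distinction. -/
lemma hasDerivAt_genGammaExponent (a : ℝ) {c s : ℝ} (hc : 0 < c) (hs : 0 < c + s) :
    HasDerivAt (genGammaExponent a c) ((c + s) ^ (a - 1)) s := by
  unfold genGammaExponent
  have h1 : HasDerivAt (fun s => c + s) 1 s := (hasDerivAt_id s).const_add c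
  by_cases h : a = 0
  · simp only [h, if_true, zero_sub, Real.rpow_neg_one]
    have h2 := (h1.div_const c).log (div_pos hs hc).ne'
    convert! h2 using 1
    field_simp
  · simp only [h, if_false]
    have h2 := ((h1.rpow_const (p := a) (Or.inl hs.ne')).sub_const (c ^ a)).div_const a
    convert! h2 using 1
    field_simp

lemma IsGenGamma.integrable_exp {μ : Measure ℝ} {γ a θ : ℝ} (h : IsGenGamma μ γ a θ) {s : ℝ}
    (hs : s ≤ 0) : Integrable (fun x => Real.exp (s * x)) μ := by
  have := h.isProbabilityMeasure
  refine (integrable_const (1 : ℝ)).mono' (by fun_prop) ?_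
  filter_upwards [h.nonneg] with x hx
  rw [Real.norm_eq_abs, Real.abs_exp]
  exact Real.exp_le_one_iff.2 (mul_nonpos_of_nonpos_of_nonneg hs hx)

lemma IsGenGamma.mem_interior_integrableExpSet {μ : Measure ℝ} {γ a θ : ℝ} (h : IsGenGamma μ γ a θ) {s : ℝ}
    (hs : s < 0) : s ∈ interior (integrableExpSet (fun x : ℝ => x) μ) :=
  _root_.mem_interior.2 ⟨Set.Iio 0, fun _ ht => h.integrable_exp (le_of_lt ht), isOpen_Iio, hs⟩

/-- Differentiate the Laplace transform `n` times. Differentiating the exponential raises `l` by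
one; differentiating `(c + s)^(al - n)` brings down `al - n`; together these are the recurrence of
the triangle. Taking `s > 0` keeps `-s` inside the interior of the domain of exponential
integrability. -/
lemma IsGenGamma.integral_pow_mul_exp {μ : Measure ℝ} {γ a θ : ℝ} (h : IsGenGamma μ γ a θ)
    (hθ : 0 < θ) (n : ℕ) {s : ℝ} (hs : 0 < s) :
    ∫ x, x ^ n * Real.exp (-(s * x)) ∂μ = Real.exp (-(γ * genGammaExponent a θ⁻¹ s)) *
      ∑ l ∈ Finset.range (n + 1), γ ^ l * (θ⁻¹ + s) ^ (a * l - n) * stirlingTriangle a n l := by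
  have hc : 0 < θ⁻¹ := inv_pos.2 hθ
  set c := θ⁻¹
  induction n generalizing s with
  | zero => simpa [stirlingTriangle] using h.laplace s hs.le
  | succ n ih =>
    have hy : 0 < c + s := by positivity
    have hL : HasDerivAt (fun s => ∫ x, x ^ n * Real.exp (-(s * x)) ∂μ)
        (-∫ x, x ^ (n + 1) * Real.exp (-(s * x)) ∂μ) s := by
      have h1 := hasDerivAt_integral_pow_mul_exp_real (h.mem_interior_integrableExpSet (neg_lt_zero.2 hs)) n
      have h2 := HasDerivAt.comp s h1 (hasDerivAt_neg s)
      simpa [Function.comp_def] using h2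
    have hR : HasDerivAt (fun s => Real.exp (-(γ * genGammaExponent a c s)) *
        ∑ l ∈ Finset.range (n + 1), γ ^ l * (c + s) ^ (a * l - n) * stirlingTriangle a n l)
        (Real.exp (-(γ * genGammaExponent a c s)) * -(γ * (c + s) ^ (a - 1)) *
          (∑ l ∈ Finset.range (n + 1), γ ^ l * (c + s) ^ (a * l - n) * stirlingTriangle a n l) +
        Real.exp (-(γ * genGammaExponent a c s)) * ∑ l ∈ Finset.range (n + 1),
          γ ^ l * (1 * (a * l - n) * (c + s) ^ (a * l - n - 1)) * stirlingTriangle a n l) s := by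
      refine HasDerivAt.mul ?_ ?_
      · exact ((hasDerivAt_genGammaExponent a hc hy).const_mul γ).neg.exp
      · refine HasDerivAt.fun_sum fun l _ => ?_
        exact ((((hasDerivAt_id s).const_add c).rpow_const (Or.inl hy.ne')).const_mul _).mul_const _
    have he : (fun s => ∫ x, x ^ n * Real.exp (-(s * x)) ∂μ) =ᶠ[nhds s]
        (fun s => Real.exp (-(γ * genGammaExponent a c s)) *
        ∑ l ∈ Finset.range (n + 1), γ ^ l * (c + s) ^ (a * l - n) * stirlingTriangle a n l) := by
      filter_upwards [lt_mem_nhds hs] with t ht using ih ht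
    have hu := (he.hasDerivAt_iff.1 hL).unique hR
    rw [neg_eq_iff_eq_neg] at hu
    rw [hu, sum_stirlingTriangle_succ, mul_assoc, ← mul_add, ← mul_neg]
    congr 1
    rw [neg_add, Finset.mul_sum, ← Finset.sum_neg_distrib, ← Finset.sum_neg_distrib]
    congr 1
    · refine Finset.sum_congr rfl fun l _ => ?_
      have : (c + s) ^ (a * ((l + 1 : ℕ) : ℝ) - ((n + 1 : ℕ) : ℝ)) =
          (c + s) ^ (a - 1) * (c + s) ^ (a * l - n) := by
        rw [← Real.rpow_add hy]
        congr 1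
        push_cast
        ring
      rw [this]
      ring
    · refine Finset.sum_congr rfl fun l _ => ?_
      have : a * (l : ℝ) - ((n + 1 : ℕ) : ℝ) = a * l - n - 1 := by
        push_cast
        ring
      rw [this]
      ring

lemma genGammaExponent_eq_gnbExponent (a : ℝ) {p t : ℝ} (hp0 : 0 < p) (hp1 : p < 1)
    (ht : t ≤ 1) : genGammaExponent a ((1 - p) / p) (1 - t) = gnbExponent a p t := by
  have hq : 0 < 1 - p := by linarith
  have hpt : 0 ≤ 1 - p * t := by nlinarith
  have h1 : (1 - p) / p + (1 - t) = (1 - p * t) / p := by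
    field_simp
    ring
  rw [genGammaExponent, gnbExponent, h1]
  split_ifs with h
  · congr 1
    field_simp
  · rw [Real.div_rpow hpt hp0.le, Real.div_rpow hq.le hp0.le]
    have := (Real.rpow_pos_of_pos hp0 a).ne'
    field_simp

lemma gnbExponent_zero (a : ℝ) (p : ℝ) : gnbExponent a p 0 = clusterRate a p := by
  simp [gnbExponent, clusterRate]

/-- `∑ₗ γ^l p^{n - al} T(n, l)`. -/
noncomputable def blockPoly (a p : ℝ) (n : ℕ) (γ : ℝ) : ℝ :=
  ∑ l ∈ Finset.range (n + 1), γ ^ l * p ^ ((n : ℝ) - a * l) * stirlingTriangle a n l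

lemma IsGenGamma.integral_pow_mul_exp_neg {μ : Measure ℝ} {γ a p : ℝ} (hp0 : 0 < p) (hp1 : p < 1)
    (h : IsGenGamma μ γ a (p / (1 - p))) (n : ℕ) :
    ∫ x, x ^ n * Real.exp (-x) ∂μ = Real.exp (-(γ * clusterRate a p)) * blockPoly a p n γ := by
  have hq : 0 < 1 - p := by linarith
  have h1 := h.integral_pow_mul_exp (div_pos hp0 hq) n one_pos
  have h2 : (1 - p) / p + 1 = p⁻¹ := by
    field_simp
    ring
  have h3 := genGammaExponent_eq_gnbExponent a hp0 hp1 zero_le_one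
  rw [sub_zero, gnbExponent_zero] at h3
  rw [inv_div, h2, h3] at h1
  simp only [one_mul] at h1
  rw [h1, blockPoly]
  congr 1
  refine Finset.sum_congr rfl fun l _ => ?_
  rw [Real.inv_rpow hp0.le, ← Real.rpow_neg hp0.le, neg_sub]

lemma blockPoly_zero (a p γ : ℝ) : blockPoly a p 0 γ = 1 := by
  simp [blockPoly, stirlingTriangle]

/-- For `n ≥ 1` the constant coefficient vanishes and the linear one is `p^(n-a)` times the block
weight; all other terms are quadratic or higher in the mass of the cell. -/
lemma exists_abs_blockPoly_sub_le {a : ℝ} (ha : a < 1) (p : ℝ) {n : ℕ} (hn : 0 < n) (γ : ℝ) :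
    ∃ C, 0 ≤ C ∧ ∀ g, 0 ≤ g → g ≤ γ →
      |blockPoly a p n g - g * (p ^ ((n : ℝ) - a) * blockWeight a n)| ≤ C * g ^ 2 := by
  obtain ⟨n, rfl⟩ := Nat.exists_eq_succ_of_ne_zero hn.ne'
  -- The coefficients of degree `l + 2`, with `g^(l+2)` bounded by `|γ|^l * g^2`.
  refine ⟨∑ l ∈ Finset.range n, |γ| ^ l * |p ^ (((n + 1 : ℕ) : ℝ) - a * ((l + 1 + 1 : ℕ) : ℝ)) *
    stirlingTriangle a (n + 1) (l + 1 + 1)|, by positivity, fun g hg0 hg => ?_⟩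
  rw [blockPoly, Finset.sum_range_succ', Finset.sum_range_succ', stirlingTriangle_succ_zero]
  simp only [Nat.succ_eq_add_one, zero_add, stirlingTriangle_one ha, pow_one, Nat.cast_one, mul_one,
    mul_zero, add_zero]
  rw [mul_assoc g, add_sub_cancel_right, Finset.sum_mul]
  refine (Finset.abs_sum_le_sum_abs _ _).trans (Finset.sum_le_sum fun l _ => ?_)
  rw [mul_assoc, abs_mul, abs_of_nonneg (pow_nonneg hg0 _), add_assoc l, pow_add, mul_right_comm]
  gcongr
  exact hg.trans (le_abs_self γ)

/-! ### Rising factorials -/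

/-- Multiply by the next factor, split as `n - ak = (n - al) - a(k - l)`: the first part keeps the
falling factorial of order `l`, the second raises its order, which matches the recurrence of the
triangle. -/
lemma ascPochhammer_eval_eq_sum (a : ℝ) (n k : ℕ) :
    (ascPochhammer ℝ n).eval (-(a * k)) =
      ∑ l ∈ Finset.range (n + 1), (-a) ^ l * (k.descFactorial l : ℝ) * stirlingTriangle a n l := by
  induction n with
  | zero => simp [stirlingTriangle]
  | succ n ih =>
    rw [ascPochhammer_succ_eval, ih, sum_stirlingTriangle_succ, ← Finset.sum_add_distrib,
      Finset.sum_mul]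
    refine Finset.sum_congr rfl fun l _ => ?_
    have h : (k.descFactorial (l + 1) : ℝ) = (k - l) * k.descFactorial l := by
      rw [Nat.descFactorial_succ]
      push_cast
      rcases le_or_gt l k with h | h
      · rw [Nat.cast_sub h]
      · simp [Nat.descFactorial_of_lt h]
    rw [h, pow_succ]
    ring

/-- The falling factorial kills the first `l` terms and cancels against `k!` in the others, leaving
the exponential series shifted by `l`. -/
lemma hasSum_descFactorial_exp (x : ℝ) (l : ℕ) :
    HasSum (fun k : ℕ => 1 / (k.factorial : ℝ) * x ^ k * k.descFactorial l)
      (x ^ l * Real.exp x) := by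
  rw [← hasSum_nat_add_iff' l]
  have h0 : ∑ k ∈ Finset.range l, 1 / (k.factorial : ℝ) * x ^ k * k.descFactorial l = 0 :=
    Finset.sum_eq_zero fun k hk => by simp [Nat.descFactorial_of_lt (Finset.mem_range.1 hk)]
  rw [h0, sub_zero, Real.exp_eq_exp_ℝ]
  convert! (NormedSpace.expSeries_div_hasSum_exp (𝔸 := ℝ) x).mul_left (x ^ l) using 2 with k
  have h : ((k + l).factorial : ℝ) = k.factorial * (k + l).descFactorial l := by
    rw [← Nat.factorial_mul_descFactorial (Nat.le_add_left l k), Nat.add_sub_cancel]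
    push_cast
    ring
  have h1 : ((k + l).descFactorial l : ℝ) ≠ 0 := by
    have : (k + l).descFactorial l ≠ 0 := by
      rw [Ne, Nat.descFactorial_eq_zero_iff_lt]
      omega
    exact_mod_cast this
  have h2 : (k.factorial : ℝ) ≠ 0 := by positivity
  rw [h, pow_add]
  field_simp

/-- Expand the rising factorial in falling factorials and sum over `k` first; the two exponentials
cancel, and `(-y) * (-a) = γ p^(-a)`. -/
lemma hasSum_ascPochhammer {a p : ℝ} (ha : a ≠ 0) (hp0 : 0 < p) (γ : ℝ) (n : ℕ) :
    HasSum (fun k : ℕ => Real.exp (γ / (a * p ^ a)) *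
        (1 / (k.factorial : ℝ) * (-(γ / (a * p ^ a))) ^ k * (ascPochhammer ℝ n).eval (-(a * k))))
      (∑ l ∈ Finset.range (n + 1), γ ^ l * p ^ (-(a * l)) * stirlingTriangle a n l) := by
  set y := γ / (a * p ^ a) with hy
  have h : HasSum (fun k : ℕ => ∑ l ∈ Finset.range (n + 1),
      (1 / (k.factorial : ℝ) * (-y) ^ k * k.descFactorial l) *
        (Real.exp y * (-a) ^ l * stirlingTriangle a n l))
      (∑ l ∈ Finset.range (n + 1), ((-y) ^ l * Real.exp (-y)) *
        (Real.exp y * (-a) ^ l * stirlingTriangle a n l)) :=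
    hasSum_sum fun l _ => (hasSum_descFactorial_exp (-y) l).mul_right _
  convert h using 1
  · funext k
    rw [ascPochhammer_eval_eq_sum, Finset.mul_sum, Finset.mul_sum]
    refine Finset.sum_congr rfl fun l _ => ?_
    ring
  · refine Finset.sum_congr rfl fun l _ => ?_
    have h1 : Real.exp (-y) * Real.exp y = 1 := by rw [← Real.exp_add]; simp
    have h2 : γ * p ^ (-a) = -y * -a := by
      rw [Real.rpow_neg hp0.le, hy]
      have := (Real.rpow_pos_of_pos hp0 a).ne'
      field_simp
    have h3 : p ^ (-(a * l)) = (p ^ (-a)) ^ l := by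
      rw [← Real.rpow_natCast, ← Real.rpow_mul hp0.le]
      ring_nf
    rw [h3, ← mul_pow, h2, mul_pow]
    linear_combination -(-y) ^ l * (-a) ^ l * stirlingTriangle a n l * h1

/-! ### The truncated negative binomial law -/

lemma ascPochhammer_eval_neg {a : ℝ} (ha : a < 1) {n : ℕ} (hn : 0 < n) :
    (ascPochhammer ℝ n).eval (-a) = -a * blockWeight a n := by
  induction n, hn using Nat.le_induction with
  | base => simp [blockWeight_one ha]
  | succ n hn ih =>
    rw [ascPochhammer_succ_eval, ih, blockWeight_succ ha hn]
    ring

lemma hasSum_ascPochhammer_pow (b : ℝ) {x : ℝ} (hx : |x| < 1) :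
    HasSum (fun n : ℕ => (ascPochhammer ℝ n).eval b / (n.factorial : ℝ) * x ^ n)
      ((1 - x) ^ (-b)) := by
  have h := (Real.one_div_one_sub_rpow_hasFPowerSeriesOnBall_zero b).hasSum (y := x)
    (by simpa [enorm_eq_nnnorm] using! hx)
  have h1 : 0 ≤ 1 - x := by linarith [(abs_lt.1 hx).2]
  simp only [zero_add] at h
  rw [one_div, ← Real.rpow_neg h1] at h
  convert! h using 2 with n
  rw [FormalMultilinearSeries.ofScalars_apply_eq, smul_eq_mul, ← Ring.multichoose_eq]
  congr 1
  have h2 := Ring.factorial_nsmul_multichoose_eq_ascPochhammer b n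
  rw [Polynomial.ascPochhammer_smeval_eq_eval, nsmul_eq_mul] at h2
  rw [← h2]
  field_simp

lemma clusterRate_pos (a : ℝ) {p : ℝ} (hp0 : 0 < p) (hp1 : p < 1) : 0 < clusterRate a p := by
  have hq : 0 < 1 - p := by linarith
  have hpa := Real.rpow_pos_of_pos hp0 a
  rw [clusterRate]
  split_ifs with h
  · exact neg_pos.2 (Real.log_neg hq (by linarith))
  · rcases lt_or_gt_of_ne h with h | h
    · exact div_pos_of_neg_of_neg (sub_neg.2
        (Real.one_lt_rpow_of_pos_of_lt_one_of_neg hq (by linarith) h))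
        (mul_neg_of_neg_of_pos h hpa)
    · exact div_pos (sub_pos.2 (Real.rpow_lt_one hq.le (by linarith) h)) (mul_pos h hpa)

/-- A form uniform in `a`, including `a = 0`, whose numerator is the per-block factor of the ECPF.
For `a ≠ 0` it comes from `Γ(1 - a) = -a Γ(-a)`. -/
lemma tnbPMFReal_eq {a p : ℝ} (ha : a < 1) (hp0 : 0 < p) (hp1 : p < 1) {u : ℕ} (hu : 0 < u) :
    tnbPMFReal a p u =
      p ^ ((u : ℝ) - a) * blockWeight a u / ((u.factorial : ℝ) * clusterRate a p) := by
  have hq : 0 < 1 - p := by linarith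
  have hpa := Real.rpow_pos_of_pos hp0 a
  have hf : (u.factorial : ℝ) ≠ 0 := by positivity
  rw [tnbPMFReal, if_neg hu.ne', blockWeight, Real.rpow_sub hp0, Real.rpow_natCast]
  have hr := (clusterRate_pos a hp0 hp1).ne'
  rw [clusterRate] at hr ⊢
  split_ifs at hr ⊢ with h
  · subst h
    obtain ⟨u, rfl⟩ := Nat.exists_eq_succ_of_ne_zero hu.ne'
    have h1 := Real.Gamma_nat_eq_factorial u
    push_cast at hr ⊢
    rw [sub_zero, sub_zero, h1, Real.Gamma_one, Nat.factorial_succ, Real.rpow_zero]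
    have : (u.factorial : ℝ) ≠ 0 := by positivity
    have hl : Real.log (1 - p) ≠ 0 := by simpa using hr
    have : (u : ℝ) + 1 ≠ 0 := by positivity
    push_cast
    field_simp
  · have hG : Real.Gamma (1 - a) = -a * Real.Gamma (-a) := by
      rw [← Real.Gamma_add_one (neg_ne_zero.2 h)]
      congr 1
      ring
    have hG0 : Real.Gamma (-a) ≠ 0 := fun h0 =>
      (Real.Gamma_pos_of_pos (sub_pos.2 ha)).ne' (by rw [hG, h0, mul_zero])
    have hQ := (Real.rpow_pos_of_pos hq a).ne'
    have hne : 1 - (1 - p) ^ a ≠ 0 := fun h0 => hr (by rw [h0, zero_div])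
    have hne2 : (1 - p) ^ a - 1 ≠ 0 := fun h0 => hne (by linarith)
    rw [hG, Real.rpow_neg hq.le]
    have h5 : 1 - ((1 - p) ^ a)⁻¹ = -((1 - (1 - p) ^ a) / (1 - p) ^ a) := by
      field_simp
      ring
    rw [h5]
    field_simp

lemma tnbPMFReal_nonneg {a p : ℝ} (ha : a < 1) (hp0 : 0 < p) (hp1 : p < 1) (u : ℕ) :
    0 ≤ tnbPMFReal a p u := by
  rcases Nat.eq_zero_or_pos u with rfl | hu
  · simp [tnbPMFReal]
  · rw [tnbPMFReal_eq ha hp0 hp1 hu]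
    have := blockWeight_pos ha hu
    have := clusterRate_pos a hp0 hp1
    positivity

lemma hasSum_tnbPMFReal {a p : ℝ} (ha : a < 1) (hp0 : 0 < p) (hp1 : p < 1) :
    HasSum (tnbPMFReal a p) 1 := by
  have hq : 0 < 1 - p := by linarith
  have habs : |p| < 1 := by rwa [abs_of_pos hp0]
  rw [← hasSum_nat_add_iff' 1]
  simp only [Finset.range_one, Finset.sum_singleton]
  rw [show tnbPMFReal a p 0 = 0 by simp [tnbPMFReal], sub_zero]
  by_cases h : a = 0
  · subst h
    have h1 := (Real.hasSum_pow_div_log_of_abs_lt_one habs).mul_left (-1 / Real.log (1 - p))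
    have hl := (Real.log_neg hq (by linarith)).ne
    rw [div_mul_eq_mul_div, neg_mul_neg, one_mul, div_self hl] at h1
    convert! h1 using 2 with n
    simp [tnbPMFReal]
  · have h1 := hasSum_ascPochhammer_pow (-a) habs
    rw [← hasSum_nat_add_iff' 1] at h1
    simp only [Finset.range_one, Finset.sum_singleton, neg_neg] at h1
    -- The binomial series without its constant term sums to `(1 - p)^a - 1`, which equals this
    -- divisor.
    have h2 := h1.div_const (-a * p ^ a * clusterRate a p)
    have hpa := (Real.rpow_pos_of_pos hp0 a).ne'
    have hr := (clusterRate_pos a hp0 hp1).ne'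
    convert! h2 using 1
    · funext n
      rw [tnbPMFReal_eq ha hp0 hp1 n.succ_pos, ascPochhammer_eval_neg ha n.succ_pos,
        Real.rpow_sub hp0, Real.rpow_natCast]
      have hf : ((n + 1).factorial : ℝ) ≠ 0 := by positivity
      field_simp
    · rw [eq_comm, div_eq_one_iff_eq (by simp [h, hpa, hr]), clusterRate, if_neg h]
      simp
      field_simp
      ring

lemma tnbMeasure_singleton (a p : ℝ) (u : ℕ) :
    tnbMeasure a p {u} = ENNReal.ofReal (tnbPMFReal a p u) := by
  rw [tnbMeasure, Measure.sum_smul_dirac_singleton]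

lemma isProbabilityMeasure_tnbMeasure {a p : ℝ} (ha : a < 1) (hp0 : 0 < p) (hp1 : p < 1) :
    IsProbabilityMeasure (tnbMeasure a p) :=
  (hasSum_tnbPMFReal ha hp0 hp1).isProbabilityMeasure_sum_dirac (tnbPMFReal_nonneg ha hp0 hp1)

/-! ### Sums over embeddings into fine partitions -/

lemma sum_embedding_eq_sum_injective {β ι M : Type*} [Fintype β] [DecidableEq β] [Fintype ι]
    [DecidableEq ι] [AddCommMonoid M] (F : (β → ι) → M) :
    ∑ σ : β ↪ ι, F σ = ∑ σ : β → ι with Function.Injective σ, F σ := by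
  rw [← Finset.sum_subtype_eq_sum_filter, Finset.subtype_univ]
  exact (Fintype.sum_equiv (Equiv.subtypeInjectiveEquivEmbedding β ι) _ _ fun σ => rfl).symm

/-- Fix the common value `j` of the two tied coordinates; they contribute `g j ^ 2` and the
remaining coordinates are free. -/
lemma sum_prod_eq_of_apply_eq {β ι : Type*} [Fintype β] [DecidableEq β] [Fintype ι]
    [DecidableEq ι] (g : ι → ℝ) {b b' : β} (hb : b ≠ b') :
    ∑ σ : β → ι with σ b = σ b', ∏ c, g (σ c) =
      (∑ j, g j ^ 2) * (∑ j, g j) ^ (Fintype.card β - 2) := by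
  have h1 : ∀ σ : β → ι, (if σ b = σ b' then ∏ c, g (σ c) else 0) =
      ∑ j, ∏ c, if c = b ∨ c = b' then (if σ c = j then g (σ c) else 0) else g (σ c) := by
    intro σ
    rw [Finset.sum_eq_single (σ b)]
    · split_ifs with h
      · refine Finset.prod_congr rfl fun c _ => ?_
        split_ifs with h1 h2
        · rfl
        · rcases h1 with rfl | rfl
          · exact absurd rfl h2
          · exact absurd h.symm h2
        · rfl
      · rw [Finset.prod_eq_zero (Finset.mem_univ b')]
        simp [Ne.symm h]
    · intro j _ hj
      rw [Finset.prod_eq_zero (Finset.mem_univ b)]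
      simp [hj.symm]
    · simp
  rw [Finset.sum_filter, Finset.sum_congr rfl fun σ _ => h1 σ, Finset.sum_comm, Finset.sum_mul]
  refine Finset.sum_congr rfl fun j _ => ?_
  have h2 := Finset.prod_univ_sum (fun _ : β => (Finset.univ : Finset ι))
    fun c i => if c = b ∨ c = b' then (if i = j then g i else 0) else g i
  simp only [Fintype.piFinset_univ] at h2
  rw [← h2]
  have h3 : ∀ c, (∑ i, if c = b ∨ c = b' then (if i = j then g i else 0) else g i) =
      if c = b ∨ c = b' then g j else ∑ i, g i := by
    intro c
    split_ifs <;> simp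
  rw [Finset.prod_congr rfl fun c _ => h3 c, Finset.prod_ite, Finset.prod_const, Finset.prod_const]
  have h4 : (Finset.univ.filter fun c => c = b ∨ c = b') = {b, b'} := by
    ext c
    simp
  have h5 : (Finset.univ.filter fun c => ¬(c = b ∨ c = b')) = {b, b'}ᶜ := by
    ext c
    simp
  rw [h4, h5, Finset.card_compl, Finset.card_pair hb]

/-- Over all maps the sum factorizes, and each factor tends to `γ * κ b` because its error is at
most `C * ∑ g²`. Maps with a collision are controlled by a union bound over the colliding pair, each
pair again costing a factor `∑ g²`. -/
lemma tendsto_sum_embedding {β : Type*} [Fintype β] [DecidableEq β] {ι : ℕ → Type*}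
    [∀ N, Fintype (ι N)] [∀ N, DecidableEq (ι N)] {g : ∀ N, ι N → ℝ} {γ : ℝ}
    (hg0 : ∀ N j, 0 ≤ g N j) (hg1 : ∀ N, ∑ j, g N j = γ)
    (hg2 : Filter.Tendsto (fun N => ∑ j, g N j ^ 2) Filter.atTop (nhds 0))
    {q : β → ℝ → ℝ} {κ : β → ℝ}
    (hq : ∀ b, ∃ C, 0 ≤ C ∧ ∀ x, 0 ≤ x → x ≤ γ → |q b x - x * κ b| ≤ C * x ^ 2) :
    Filter.Tendsto (fun N => ∑ σ : β ↪ ι N, ∏ b, q b (g N (σ b))) Filter.atTop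
      (nhds (∏ b, (γ * κ b))) := by
  choose C hC0 hC using hq
  have hle : ∀ N j, g N j ≤ γ := fun N j => by
    rw [← hg1 N]
    exact Finset.single_le_sum (fun i _ => hg0 N i) (Finset.mem_univ j)
  have hγ : 0 ≤ γ := by
    rw [← hg1 0]
    exact Finset.sum_nonneg fun j _ => hg0 0 j
  -- One constant giving `|q b x| ≤ D * x` for every `b` on `[0, γ]`.
  set D := ∑ b, (|κ b| + C b * γ) with hD
  have hDb : ∀ b, |κ b| + C b * γ ≤ D := fun b =>
    Finset.single_le_sum (f := fun b => |κ b| + C b * γ)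
      (fun i _ => add_nonneg (abs_nonneg _) (mul_nonneg (hC0 i) hγ)) (Finset.mem_univ b)
  have hD0 : 0 ≤ D := Finset.sum_nonneg fun i _ =>
    add_nonneg (abs_nonneg _) (mul_nonneg (hC0 i) hγ)
  have hqD : ∀ b x, 0 ≤ x → x ≤ γ → |q b x| ≤ D * x := by
    intro b x h0 h1
    have h2 := hC b x h0 h1
    have h3 : |q b x| ≤ |q b x - x * κ b| + |x * κ b| := by
      simpa using abs_add_le (q b x - x * κ b) (x * κ b)
    rw [abs_mul, abs_of_nonneg h0] at h3
    have h4 : C b * x ^ 2 ≤ C b * γ * x := by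
      rw [sq, ← mul_assoc]
      gcongr
      exact hC0 b
    nlinarith [mul_le_mul_of_nonneg_right (hDb b) h0]
  have hall : Filter.Tendsto (fun N => ∑ σ : β → ι N, ∏ b, q b (g N (σ b))) Filter.atTop
      (nhds (∏ b, (γ * κ b))) := by
    have h1 : ∀ N, ∑ σ : β → ι N, ∏ b, q b (g N (σ b)) = ∏ b, ∑ j, q b (g N j) := by
      intro N
      rw [Finset.prod_univ_sum, Fintype.piFinset_univ]
    simp only [h1]
    refine tendsto_finsetProd _ fun b _ => ?_
    rw [tendsto_iff_norm_sub_tendsto_zero]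
    refine squeeze_zero (fun _ => norm_nonneg _) (g := fun N => C b * ∑ j, g N j ^ 2)
      (fun N => ?_) (by simpa using hg2.const_mul (C b))
    rw [← hg1 N, Finset.sum_mul, ← Finset.sum_sub_distrib, Finset.mul_sum, Real.norm_eq_abs]
    exact (Finset.abs_sum_le_sum_abs _ _).trans
      (Finset.sum_le_sum fun j _ => hC b _ (hg0 N j) (hle N j))
  have hnon : Filter.Tendsto (fun N => ∑ σ : β → ι N with ¬Function.Injective σ,
      ∏ b, q b (g N (σ b))) Filter.atTop (nhds 0) := by
    refine squeeze_zero_norm (a := fun N => D ^ Fintype.card β * ∑ b : β × β,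
      (∑ j, g N j ^ 2) * γ ^ (Fintype.card β - 2)) (fun N => ?_) ?_
    · rw [Real.norm_eq_abs]
      have hp : ∀ σ : β → ι N, 0 ≤ ∏ b, g N (σ b) := fun σ =>
        Finset.prod_nonneg fun b _ => hg0 N _
      calc |∑ σ : β → ι N with ¬Function.Injective σ, ∏ b, q b (g N (σ b))|
          ≤ ∑ σ : β → ι N with ¬Function.Injective σ, |∏ b, q b (g N (σ b))| :=
            Finset.abs_sum_le_sum_abs _ _
        _ ≤ ∑ σ : β → ι N with ¬Function.Injective σ,
              D ^ Fintype.card β * ∏ b, g N (σ b) := by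
            refine Finset.sum_le_sum fun σ _ => ?_
            rw [Finset.abs_prod, ← Finset.card_univ, ← Finset.prod_const,
              ← Finset.prod_mul_distrib]
            exact Finset.prod_le_prod (fun _ _ => abs_nonneg _)
              fun b _ => hqD b _ (hg0 N _) (hle N _)
        _ = D ^ Fintype.card β *
              ∑ σ : β → ι N with ¬Function.Injective σ, ∏ b, g N (σ b) := by
            rw [Finset.mul_sum]
        _ ≤ D ^ Fintype.card β * ∑ b : β × β, if b.1 = b.2 then 0 else
              ∑ σ : β → ι N with σ b.1 = σ b.2, ∏ b, g N (σ b) := by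
            gcongr
            have : ∀ b : β × β, (if b.1 = b.2 then 0 else
                ∑ σ : β → ι N with σ b.1 = σ b.2, ∏ b, g N (σ b)) =
                ∑ σ : β → ι N, if b.1 ≠ b.2 ∧ σ b.1 = σ b.2 then ∏ b, g N (σ b) else 0 := by
              intro b
              split_ifs with h
              · simp [h]
              · simp [h, Finset.sum_filter]
            rw [Finset.sum_congr rfl fun b _ => this b, Finset.sum_comm, Finset.sum_filter]
            refine Finset.sum_le_sum fun σ _ => ?_
            split_ifs with h
            · refine Finset.sum_nonneg fun b _ => ?_
              split_ifs
              exacts [hp σ, le_rfl]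
            · obtain ⟨b, b', h1, h2⟩ : ∃ b b', σ b = σ b' ∧ b ≠ b' := by
                simpa [Function.Injective] using h
              refine le_trans ?_ (Finset.single_le_sum
                (f := fun b : β × β => if b.1 ≠ b.2 ∧ σ b.1 = σ b.2 then
                  ∏ b, g N (σ b) else 0) (fun b _ => ?_) (Finset.mem_univ (b, b')))
              · simp [h1, h2]
              · split_ifs
                exacts [hp σ, le_rfl]
        _ ≤ _ := by
            refine mul_le_mul_of_nonneg_left (Finset.sum_le_sum fun b _ => ?_) (by positivity)
            split_ifs with h
            · positivity
            · rw [sum_prod_eq_of_apply_eq (g N) h, hg1]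
    · have := (tendsto_finsetSum (Finset.univ : Finset (β × β)) fun _ _ =>
        hg2.mul_const (γ ^ (Fintype.card β - 2))).const_mul (D ^ Fintype.card β)
      simpa using this
  have h := hall.sub hnon
  rw [sub_zero] at h
  refine h.congr fun N => ?_
  rw [sum_embedding_eq_sum_injective fun σ : β → ι N => ∏ b, q b (g N (σ b)), sub_eq_iff_eq_add]
  exact (Finset.sum_filter_add_sum_filter_not _ _ _).symm

/-! ### Cells of a separating sequence -/

/-- The first `N` bits of a sequence. -/
def cell {S : Type*} (f : S → ℕ → Bool) (N : ℕ) (s : S) : Fin N → Bool := fun i => f s i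

lemma measurable_cell {S : Type*} [MeasurableSpace S] {f : S → ℕ → Bool} (hf : Measurable f)
    (N : ℕ) : Measurable (cell f N) :=
  measurable_pi_lambda _ fun i => (measurable_pi_apply (i : ℕ)).comp hf

lemma eventually_cell_eq_iff {S : Type*} {f : S → ℕ → Bool} (hf : Function.Injective f)
    (s t : S) : ∀ᶠ N in Filter.atTop, cell f N s = cell f N t ↔ s = t := by
  by_cases h : s = t
  · exact Filter.Eventually.of_forall fun N => by simp [h]
  · obtain ⟨d, hd⟩ := Function.ne_iff.1 (hf.ne h)
    filter_upwards [Filter.eventually_gt_atTop d] with N hN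
    simp only [h, iff_false]
    exact fun h' => hd (congrFun h' ⟨d, hN⟩)

lemma sum_measureReal_preimage_singleton_univ {S ι : Type*} [MeasurableSpace S] [Fintype ι]
    [MeasurableSpace ι] [MeasurableSingletonClass ι] (μ : Measure S) [IsFiniteMeasure μ]
    {h : S → ι} (hh : Measurable h) : ∑ j, μ.real (h ⁻¹' {j}) = μ.real Set.univ := by
  rw [sum_measureReal_preimage_singleton _ fun j _ => hh (measurableSet_singleton j)]
  simp

/-- The sum is the `μ × μ` measure of the pairs lying in one cell. These sets converge to the
diagonal, which is null by Fubini since points have measure zero. -/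
lemma tendsto_sum_cell_sq {S : Type*} [MeasurableSpace S] (μ : Measure S) [IsFiniteMeasure μ]
    [NullSingletonClass μ] {f : S → ℕ → Bool} (hf : Measurable f) (hf' : Function.Injective f) :
    Filter.Tendsto (fun N => ∑ j, μ.real (cell f N ⁻¹' {j}) ^ 2) Filter.atTop (nhds 0) := by
  have hsum : ∀ N, ∑ j, μ.real (cell f N ⁻¹' {j}) ^ 2 =
      (μ.prod μ).real {q | cell f N q.1 = cell f N q.2} := by
    intro N
    have hm := measurable_cell hf N
    have h1 : {q : S × S | cell f N q.1 = cell f N q.2} =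
        ⋃ j ∈ (Finset.univ : Finset (Fin N → Bool)),
          (cell f N ⁻¹' {j}) ×ˢ (cell f N ⁻¹' {j}) := by
      ext q
      simp [eq_comm]
    rw [h1, measureReal_biUnion_finset]
    · refine Finset.sum_congr rfl fun j _ => ?_
      rw [measureReal_prod_prod, sq]
    · intro i _ j _ hij
      refine Set.disjoint_left.2 fun q hq hq' => hij ?_
      rw [← hq.1, ← hq'.1]
    · exact fun j _ => (hm (measurableSet_singleton j)).prod (hm (measurableSet_singleton j))
  have hlim := tendsto_measure_of_tendsto_indicator_of_isFiniteMeasure (A := Set.diagonal S)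
    Filter.atTop (μ.prod μ) (As := fun N => {q | cell f N q.1 = cell f N q.2})
    (fun N => measurableSet_eq_fun ((measurable_cell hf N).comp measurable_fst)
      ((measurable_cell hf N).comp measurable_snd))
    (fun q => eventually_cell_eq_iff hf' q.1 q.2)
  have hdiag : μ.prod μ (Set.diagonal S) = 0 := by
    have hd : MeasurableSet (Set.diagonal S) := measurableSet_of_tendsto_indicator Filter.atTop
      (As := fun N => {q : S × S | cell f N q.1 = cell f N q.2})
      (fun N => measurableSet_eq_fun ((measurable_cell hf N).comp measurable_fst)
        ((measurable_cell hf N).comp measurable_snd))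
      (fun q => eventually_cell_eq_iff hf' q.1 q.2)
    rw [Measure.prod_apply hd]
    have : ∀ s, Prod.mk s ⁻¹' Set.diagonal S = {s} := by
      intro s
      ext t
      simp [eq_comm]
    simp [this]
  rw [hdiag] at hlim
  simp only [hsum]
  simp only [measureReal_def]
  exact (ENNReal.tendsto_toReal_zero_iff (fun N => measure_ne_top _ _)).2 hlim

/-! ### Moments of a generalized gamma process -/

section GammaProcess

variable {Ω S : Type*} [MeasurableSpace Ω] [MeasurableSpace S] {P : Measure Ω}
  {G : Ω → Measure S} {G₀ : Measure S} {a p : ℝ}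

lemma IsGenGammaProcess.measurable_apply {c : ℝ} (hG : IsGenGammaProcess P G G₀ a c) {A : Set S}
    (hA : MeasurableSet A) : Measurable fun ω => G ω A :=
  (Measure.measurable_coe hA).comp hG.measurable

lemma IsGenGammaProcess.measurable_real {c : ℝ} (hG : IsGenGammaProcess P G G₀ a c) {A : Set S}
    (hA : MeasurableSet A) : Measurable fun ω => (G ω).real A :=
  (hG.measurable_apply hA).ennreal_toReal

lemma IsGenGamma.integrable_pow_mul_exp_neg {μ : Measure ℝ} {γ θ : ℝ} (h : IsGenGamma μ γ a θ)
    (n : ℕ) : Integrable (fun x => x ^ n * Real.exp (-x)) μ := by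
  simpa using integrable_pow_mul_exp_of_mem_interior_integrableExpSet
    (h.mem_interior_integrableExpSet (by norm_num : (-1 : ℝ) < 0)) n

lemma IsGenGammaProcess.lintegral_pow_mul_exp_neg (hp0 : 0 < p) (hp1 : p < 1)
    (hG : IsGenGammaProcess P G G₀ a ((1 - p) / p)) {A : Set S} (hA : MeasurableSet A) (n : ℕ) :
    ∫⁻ ω, ENNReal.ofReal ((G ω).real A ^ n * Real.exp (-(G ω).real A)) ∂P =
      ENNReal.ofReal (Real.exp (-(G₀.real A * clusterRate a p)) *
        blockPoly a p n (G₀.real A)) := by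
  have h := hG.law A hA
  rw [inv_div] at h
  rw [← h.integral_pow_mul_exp_neg hp0 hp1 n, ofReal_integral_eq_lintegral_ofReal
    (h.integrable_pow_mul_exp_neg n), lintegral_map (by fun_prop) (hG.measurable_real hA)]
  filter_upwards [h.nonneg] with x hx
  positivity

lemma IsGenGammaProcess.exp_mul_blockPoly_nonneg (hp0 : 0 < p) (hp1 : p < 1)
    (hG : IsGenGammaProcess P G G₀ a ((1 - p) / p)) {A : Set S} (hA : MeasurableSet A) (n : ℕ) :
    0 ≤ Real.exp (-(G₀.real A * clusterRate a p)) * blockPoly a p n (G₀.real A) := by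
  have h := hG.law A hA
  rw [inv_div] at h
  rw [← h.integral_pow_mul_exp_neg hp0 hp1 n]
  refine integral_nonneg_of_ae ?_
  filter_upwards [h.nonneg] with x hx
  positivity

lemma IsGenGammaProcess.iIndepFun_preimage {c : ℝ} (hG : IsGenGammaProcess P G G₀ a c)
    {ι : Type*} [Fintype ι] [MeasurableSpace ι] [MeasurableSingletonClass ι] {h : S → ι}
    (hh : Measurable h) : iIndepFun (fun j ω => G ω (h ⁻¹' {j})) P := by
  let e := Fintype.equivFin ι
  have h1 := hG.indep (Fintype.card ι) (fun i => h ⁻¹' {e.symm i})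
    (fun i => hh (measurableSet_singleton _)) (fun i j hij => by
      refine Set.disjoint_left.2 fun s hs hs' => hij (e.symm.injective ?_)
      rw [← hs, ← hs'])
  have h2 := h1.precomp e.injective
  simpa using h2

/-- Additivity spreads `e^{-G(S)}` over the cells, so the integrand is a product of functions of the
independent cell masses, one tilted moment per cell. -/
lemma IsGenGammaProcess.lintegral_exp_mul_prod (hp0 : 0 < p) (hp1 : p < 1)
    (hG : IsGenGammaProcess P G G₀ a ((1 - p) / p)) {ι : Type*} [Fintype ι] [DecidableEq ι]
    [MeasurableSpace ι] [MeasurableSingletonClass ι] {h : S → ι} (hh : Measurable h) {n : ℕ}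
    (κ : Fin n → ι) :
    ∫⁻ ω, ENNReal.ofReal (Real.exp (-(G ω).real Set.univ)) * ∏ i, G ω (h ⁻¹' {κ i}) ∂P =
      ENNReal.ofReal (∏ j, (Real.exp (-(G₀.real (h ⁻¹' {j}) * clusterRate a p)) *
        blockPoly a p (Finset.univ.filter fun i => κ i = j).card (G₀.real (h ⁻¹' {j})))) := by
  have hA : ∀ j, MeasurableSet (h ⁻¹' {j}) := fun j => hh (measurableSet_singleton j)
  rw [ENNReal.ofReal_prod_of_nonneg fun j _ => hG.exp_mul_blockPoly_nonneg hp0 hp1 (hA j) _]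
  simp only [← hG.lintegral_pow_mul_exp_neg hp0 hp1 (hA _)]
  have hind := (hG.iIndepFun_preimage hh).comp
    (fun j x => ENNReal.ofReal (x.toReal ^ (Finset.univ.filter fun i => κ i = j).card *
      Real.exp (-x.toReal))) (fun j => by fun_prop)
  have hprod := lintegral_prod_eq_prod_lintegral_of_indepFun Finset.univ _ hind fun j =>
    Measurable.comp (by fun_prop) (hG.measurable_apply (hA j))
  simp only [Function.comp_apply] at hprod
  simp only [measureReal_def] at hprod ⊢
  rw [← hprod]
  refine lintegral_congr_ae ?_
  filter_upwards [hG.finite] with ω hω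
  have : IsFiniteMeasure (G ω) := ⟨hω⟩
  have h1 : Real.exp (-(G ω Set.univ).toReal) =
      ∏ j, Real.exp (-(G ω (h ⁻¹' {j})).toReal) := by
    rw [← Real.exp_sum, Finset.sum_neg_distrib]
    congr 2
    exact (sum_measureReal_preimage_singleton_univ (G ω) hh).symm
  have h2 : ∏ i, G ω (h ⁻¹' {κ i}) =
      ENNReal.ofReal (∏ j, (G ω (h ⁻¹' {j})).toReal ^
        (Finset.univ.filter fun i => κ i = j).card) := by
    rw [ENNReal.ofReal_prod_of_nonneg fun j _ => by positivity,
      ← Finset.prod_fiberwise_of_maps_to (s := Finset.univ) (t := Finset.univ) (g := κ)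
        (fun _ _ => Finset.mem_univ _)]
    refine Finset.prod_congr rfl fun j _ => ?_
    rw [Finset.prod_congr rfl fun i hi => by rw [(Finset.mem_filter.1 hi).2], Finset.prod_const,
      ENNReal.ofReal_pow ENNReal.toReal_nonneg, ENNReal.ofReal_toReal (measure_ne_top _ _)]
  rw [h1, h2, ← ENNReal.ofReal_mul (Finset.prod_nonneg fun j _ => (Real.exp_pos _).le),
    ← Finset.prod_mul_distrib, ENNReal.ofReal_prod_of_nonneg fun j _ => by positivity]
  simp only [mul_comm]

/-- Cells receiving no block contribute only their exponential, as `blockPoly` of order `0` is `1`;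
the exponentials combine by additivity of `G₀`. -/
lemma prod_blockPoly_embedding [IsFiniteMeasure G₀] {ι : Type*} [Fintype ι] [DecidableEq ι]
    [MeasurableSpace ι] [MeasurableSingletonClass ι] {h : S → ι} (hh : Measurable h) {n : ℕ}
    (π : Finpartition (Finset.univ : Finset (Fin n))) (σ : π.parts ↪ ι) :
    ∏ j, (Real.exp (-(G₀.real (h ⁻¹' {j}) * clusterRate a p)) *
        blockPoly a p (Finset.univ.filter fun i => σ (π.toBlock i) = j).card
          (G₀.real (h ⁻¹' {j}))) =
      Real.exp (-(G₀.real Set.univ * clusterRate a p)) *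
        ∏ B : π.parts, blockPoly a p B.1.card (G₀.real (h ⁻¹' {σ B})) := by
  rw [Finset.prod_mul_distrib, ← Real.exp_sum, Finset.sum_neg_distrib, ← Finset.sum_mul,
    sum_measureReal_preimage_singleton_univ G₀ hh]
  congr 1
  symm
  refine Fintype.prod_of_injective σ σ.injective _ _ ?_ ?_
  · intro j hj
    rw [Finset.filter_false_of_mem fun i _ hi => hj ⟨_, hi⟩, Finset.card_empty, blockPoly_zero]
  · intro B
    rw [← π.filter_toBlock B]
    simp only [σ.injective.eq_iff]

lemma IsGenGammaProcess.tendsto_lintegral_cell [IsFiniteMeasure G₀] [NullSingletonClass G₀]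
    (ha : a < 1) (hp0 : 0 < p) (hp1 : p < 1)
    (hG : IsGenGammaProcess P G G₀ a ((1 - p) / p)) {f : S → ℕ → Bool} (hf : Measurable f)
    (hf' : Function.Injective f) {n : ℕ} (π : Finpartition (Finset.univ : Finset (Fin n))) :
    Filter.Tendsto (fun N => ∫⁻ ω, ENNReal.ofReal (Real.exp (-(G ω).real Set.univ)) *
        ∑ κ : Fin n → Fin N → Bool with tiePartition κ = π, ∏ i, G ω (cell f N ⁻¹' {κ i}) ∂P)
      Filter.atTop (nhds (ENNReal.ofReal (Real.exp (-(G₀.real Set.univ * clusterRate a p)) *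
        ∏ B : π.parts, (G₀.real Set.univ *
          (p ^ ((B.1.card : ℝ) - a) * blockWeight a B.1.card))))) := by
  have h1 : ∀ N, ∫⁻ ω, ENNReal.ofReal (Real.exp (-(G ω).real Set.univ)) *
        ∑ κ : Fin n → Fin N → Bool with tiePartition κ = π, ∏ i, G ω (cell f N ⁻¹' {κ i}) ∂P =
      ENNReal.ofReal (Real.exp (-(G₀.real Set.univ * clusterRate a p)) *
        ∑ σ : π.parts ↪ (Fin N → Bool),
          ∏ B : π.parts, blockPoly a p B.1.card (G₀.real (cell f N ⁻¹' {σ B}))) := by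
    intro N
    have hm := measurable_cell hf N
    have hA : ∀ j, MeasurableSet (cell f N ⁻¹' {j}) := fun j => hm (measurableSet_singleton j)
    simp only [Finset.mul_sum]
    rw [lintegral_finsetSum' _ fun κ _ => ?_]
    · rw [sum_filter_tiePartition_eq π fun κ : Fin n → Fin N → Bool => ∫⁻ ω,
        ENNReal.ofReal (Real.exp (-(G ω).real Set.univ)) * ∏ i, G ω (cell f N ⁻¹' {κ i}) ∂P,
        ENNReal.ofReal_sum_of_nonneg fun σ _ => ?_]
      · refine Finset.sum_congr rfl fun σ _ => ?_
        rw [hG.lintegral_exp_mul_prod hp0 hp1 hm, prod_blockPoly_embedding hm]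
      · rw [← prod_blockPoly_embedding hm]
        exact Finset.prod_nonneg fun j _ => hG.exp_mul_blockPoly_nonneg hp0 hp1 (hA j) _
    · exact ((hG.measurable_real MeasurableSet.univ).neg.exp.ennreal_ofReal.mul
        (Finset.measurable_prod _ fun i _ => hG.measurable_apply (hA _))).aemeasurable
  simp only [h1]
  refine (ENNReal.continuous_ofReal.tendsto _).comp (Filter.Tendsto.const_mul _ ?_)
  refine tendsto_sum_embedding (g := fun N j => G₀.real (cell f N ⁻¹' {j}))
    (q := fun B : π.parts => blockPoly a p B.1.card) (fun N j => measureReal_nonneg)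
    (fun N => sum_measureReal_preimage_singleton_univ G₀ (measurable_cell hf N))
    (tendsto_sum_cell_sq G₀ hf hf') fun B => ?_
  exact exists_abs_blockPoly_sub_le ha p (Finset.card_pos.2 (π.nonempty_of_mem_parts B.2)) _

end GammaProcess

/-! ### The count-mixture model -/

/-- The random measure on the atom indices with the weights of the atoms. -/
noncomputable def indexMeasure {Ω : Type*} (w : ℕ → Ω → ℝ≥0) (ω : Ω) : Measure ℕ :=
  Measure.sum fun k => (w k ω : ℝ≥0∞) • Measure.dirac k

lemma indexMeasure_singleton {Ω : Type*} (w : ℕ → Ω → ℝ≥0) (ω : Ω) (k : ℕ) : indexMeasure w ω {k} = w k ω := by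
  rw [indexMeasure, Measure.sum_smul_dirac_singleton]

lemma atomicMeasure_apply {Ω S : Type*} [MeasurableSpace S] (w : ℕ → Ω → ℝ≥0) (x : ℕ → Ω → S) (ω : Ω) {A : Set S}
    (hA : MeasurableSet A) : atomicMeasure w x ω A = indexMeasure w ω {k | x k ω ∈ A} := by
  rw [atomicMeasure, indexMeasure, Measure.sum_apply _ hA, Measure.sum_apply _ .of_discrete]
  refine tsum_congr fun k => ?_
  simp only [Measure.smul_apply, Measure.dirac_apply' _ hA,
    Measure.dirac_apply' _ (MeasurableSet.of_discrete (s := {k | x k ω ∈ A}))]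
  rfl

lemma atomicMeasure_univ {Ω S : Type*} [MeasurableSpace S] (w : ℕ → Ω → ℝ≥0) (x : ℕ → Ω → S) (ω : Ω) :
    atomicMeasure w x ω Set.univ = indexMeasure w ω Set.univ := by
  rw [atomicMeasure_apply w x ω MeasurableSet.univ]
  simp

lemma pi_indexMeasure_apply {Ω : Type*} (w : ℕ → Ω → ℝ≥0) (ω : Ω) [IsFiniteMeasure (indexMeasure w ω)] {n : ℕ}
    (K : Set (Fin n → ℕ)) : Measure.pi (fun _ : Fin n => indexMeasure w ω) K =
      ∑' k, K.indicator (fun k => ∏ i, (w (k i) ω : ℝ≥0∞)) k := by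
  rw [← Measure.tsum_indicator_apply_singleton _ K .of_discrete]
  simp [Measure.pi_singleton, indexMeasure_singleton]

lemma pi_indexMeasure_cell {Ω S : Type*} [MeasurableSpace S] (w : ℕ → Ω → ℝ≥0) (x : ℕ → Ω → S) (ω : Ω)
    [IsFiniteMeasure (indexMeasure w ω)] {ι : Type*} [Fintype ι] [DecidableEq ι]
    [MeasurableSpace ι] [MeasurableSingletonClass ι] {h : S → ι} (hh : Measurable h) {n : ℕ}
    (π : Finpartition (Finset.univ : Finset (Fin n))) :
    Measure.pi (fun _ : Fin n => indexMeasure w ω)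
        {k | tiePartition (fun i => h (x (k i) ω)) = π} =
      ∑ κ : Fin n → ι with tiePartition κ = π, ∏ i, atomicMeasure w x ω (h ⁻¹' {κ i}) := by
  have h1 : {k : Fin n → ℕ | tiePartition (fun i => h (x (k i) ω)) = π} =
      ⋃ κ ∈ Finset.univ.filter fun κ : Fin n → ι => tiePartition κ = π,
        Set.univ.pi fun i => {k | x k ω ∈ h ⁻¹' {κ i}} := by
    ext k
    simp only [Set.mem_ofPred_eq, Finset.mem_filter, Finset.mem_univ, true_and, Set.mem_iUnion,
      Set.mem_pi, Set.mem_univ, forall_const, Set.mem_preimage, Set.mem_singleton_iff,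
      exists_prop]
    constructor
    · exact fun hk => ⟨_, hk, fun i => rfl⟩
    · rintro ⟨κ, hκ, hk⟩
      rw [← hκ]
      congr 1
      exact funext hk
  rw [h1, measure_biUnion_finset]
  · refine Finset.sum_congr rfl fun κ _ => ?_
    rw [Measure.pi_pi]
    exact Finset.prod_congr rfl fun i _ =>
      (atomicMeasure_apply w x ω (hh (measurableSet_singleton _))).symm
  · intro κ _ κ' _ hne
    refine Set.disjoint_left.2 fun k hk hk' => hne (funext fun i => ?_)
    have h2 := hk i (Set.mem_univ i)
    have h3 := hk' i (Set.mem_univ i)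
    simp only [Set.mem_ofPred_eq, Set.mem_preimage, Set.mem_singleton_iff] at h2 h3
    rw [← h2, ← h3]
  · exact fun κ _ => .of_discrete

/-- Tuples using an atom of weight zero are null. On every other tuple the locations are distinct
for distinct indices, so finitely many bits eventually decide all ties. -/
lemma tendsto_pi_indexMeasure_cell {Ω S : Type*} (w : ℕ → Ω → ℝ≥0) (x : ℕ → Ω → S) (ω : Ω)
    [IsFiniteMeasure (indexMeasure w ω)]
    (hx : ∀ j k, w j ω ≠ 0 → w k ω ≠ 0 → x j ω = x k ω → j = k) {f : S → ℕ → Bool}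
    (hf : Function.Injective f) {n : ℕ} (π : Finpartition (Finset.univ : Finset (Fin n))) :
    Filter.Tendsto (fun N => Measure.pi (fun _ : Fin n => indexMeasure w ω)
        {k | tiePartition (fun i => cell f N (x (k i) ω)) = π}) Filter.atTop
      (nhds (Measure.pi (fun _ : Fin n => indexMeasure w ω) {k | tiePartition k = π})) := by
  refine tendsto_measure_of_ae_tendsto_indicator_of_isFiniteMeasure _ .of_discrete
    (fun _ => .of_discrete) (ae_iff_of_countable.2 fun k hk => ?_)
  rw [Measure.pi_singleton, Finset.prod_ne_zero_iff] at hk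
  have hw : ∀ i, w (k i) ω ≠ 0 := fun i => by
    have := hk i (Finset.mem_univ i)
    rw [indexMeasure_singleton] at this
    exact_mod_cast this
  have h1 : ∀ᶠ N in Filter.atTop, ∀ i j,
      cell f N (x (k i) ω) = cell f N (x (k j) ω) ↔ k i = k j := by
    simp only [Filter.eventually_all]
    intro i j
    filter_upwards [eventually_cell_eq_iff hf (x (k i) ω) (x (k j) ω)] with N hN
    rw [hN]
    exact ⟨hx _ _ (hw i) (hw j), fun h => by rw [h]⟩
  filter_upwards [h1] with N hN
  rw [tiePartition_congr hN]

/-- The cancellation of `T^n` also holds at `T = 0`: with division by zero equal to zero, both sides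
are `1` for `n = 0` and `0` for `n > 0`. -/
lemma exp_mul_pow_div_mul_prod_div {T : ℝ} (hT : 0 ≤ T) {n : ℕ} (y : Fin n → ℝ)
    (hy : T = 0 → ∀ i, y i = 0) :
    Real.exp (-T) * T ^ n / (n.factorial : ℝ) * ∏ i, (y i / T) =
      Real.exp (-T) / (n.factorial : ℝ) * ∏ i, y i := by
  rcases hT.eq_or_lt with rfl | hT
  · rcases Nat.eq_zero_or_pos n with rfl | hn
    · simp
    · rw [Finset.prod_eq_zero (Finset.mem_univ ⟨0, hn⟩) (hy rfl _)]
      simp [hn.ne']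
  · rw [Finset.prod_div_distrib, Finset.prod_const, Finset.card_univ, Fintype.card_fin]
    field_simp

lemma isFiniteMeasure_indexMeasure {Ω S : Type*} [MeasurableSpace S]
    {w : ℕ → Ω → ℝ≥0} {x : ℕ → Ω → S} {ω : Ω} (hω : atomicMeasure w x ω Set.univ < ∞) :
    IsFiniteMeasure (indexMeasure w ω) :=
  ⟨by rwa [atomicMeasure_univ] at hω⟩

lemma ofReal_exp_mul_pow_le_one {t : ℝ≥0∞} (ht : t ≠ ∞) (n : ℕ) :
    ENNReal.ofReal (Real.exp (-t.toReal) / n.factorial) * t ^ n ≤ 1 := by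
  have h1 : t ^ n = ENNReal.ofReal (t.toReal ^ n) := by
    rw [ENNReal.ofReal_pow ENNReal.toReal_nonneg, ENNReal.ofReal_toReal ht]
  rw [h1, ← ENNReal.ofReal_mul (by positivity)]
  refine ENNReal.ofReal_le_one.2 ?_
  have h2 := Real.pow_div_factorial_le_exp t.toReal ENNReal.toReal_nonneg n
  calc Real.exp (-t.toReal) / n.factorial * t.toReal ^ n
      = Real.exp (-t.toReal) * (t.toReal ^ n / n.factorial) := by ring
    _ ≤ Real.exp (-t.toReal) * Real.exp t.toReal := by gcongr
    _ = 1 := by rw [← Real.exp_add]; simp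

lemma clusterEvent_eq {Ω : Type*} (m : Ω → ℕ) (z : ℕ → Ω → ℕ) {n : ℕ}
    (π : Finpartition (Finset.univ : Finset (Fin n))) :
    clusterEvent m z π =
      {ω | m ω = n ∧ (fun i : Fin n => z i ω) ∈ {k : Fin n → ℕ | tiePartition k = π}} :=
  rfl

lemma card_parts_prod {n : ℕ} (a p γ : ℝ) (hp0 : 0 < p)
    (π : Finpartition (Finset.univ : Finset (Fin n))) :
    ∏ B : π.parts, (γ * (p ^ ((B.1.card : ℝ) - a) * blockWeight a B.1.card)) =
      γ ^ π.parts.card * p ^ ((n : ℝ) - a * π.parts.card) *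
        ∏ B ∈ π.parts, blockWeight a B.card := by
  rw [Finset.prod_coe_sort π.parts
    fun B => γ * (p ^ ((B.card : ℝ) - a) * blockWeight a B.card), Finset.prod_mul_distrib,
    Finset.prod_mul_distrib, Finset.prod_const, ← Real.rpow_sum_of_pos hp0,
    Finset.sum_sub_distrib, ← Nat.cast_sum, π.sum_card_parts, mul_assoc]
  simp [mul_comm]

section Mixture

variable {Ω S : Type*} [MeasurableSpace Ω] [MeasurableSpace S] {P : Measure Ω}
  {w : ℕ → Ω → ℝ≥0} {x : ℕ → Ω → S} {m : Ω → ℕ} {z : ℕ → Ω → ℕ}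

lemma IsCountMixture.measurableSet (hmodel : IsCountMixture P w x m z) (n : ℕ)
    (K : Set (Fin n → ℕ)) : MeasurableSet {ω | m ω = n ∧ (fun i : Fin n => z i ω) ∈ K} :=
  (hmodel.measurable_size (measurableSet_singleton n)).inter
    ((measurable_pi_lambda _ fun i : Fin n => hmodel.measurable_index i)
      (MeasurableSet.of_discrete (s := K)))

lemma IsCountMixture.atomSigma_le (hmodel : IsCountMixture P w x m z) :
    atomSigma w x ≤ ‹MeasurableSpace Ω› :=
  iSup_le fun k => sup_le (hmodel.measurable_weight k).comap_le (hmodel.measurable_loc k).comap_le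

lemma IsCountMixture.measure_singleton [IsProbabilityMeasure P]
    (hmodel : IsCountMixture P w x m z)
    (hfin : ∀ᵐ ω ∂P, atomicMeasure w x ω Set.univ < ∞) (n : ℕ) (k : Fin n → ℕ) :
    P {ω | m ω = n ∧ (fun i : Fin n => z i ω) = k} =
      ∫⁻ ω, ENNReal.ofReal (Real.exp (-(atomicMeasure w x ω).real Set.univ) / n.factorial) *
        ∏ i, (w (k i) ω : ℝ≥0∞) ∂P := by
  have hset : {ω | m ω = n ∧ (fun i : Fin n => z i ω) = k} =
      {ω | m ω = n ∧ ∀ i : Fin n, z i ω = k i} := by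
    ext ω
    simp [funext_iff]
  have hms : MeasurableSet {ω | m ω = n ∧ ∀ i : Fin n, z i ω = k i} := by
    rw [← hset]
    exact hmodel.measurableSet n {k}
  have h1 := hmodel.condLaw n k
  have h2 := integral_condExp (μ := P) (f := Set.indicator
    {ω | m ω = n ∧ ∀ i : Fin n, z i ω = k i} fun _ => (1 : ℝ)) hmodel.atomSigma_le
  rw [integral_congr_ae h1, integral_indicator_const _ hms, smul_eq_mul, mul_one] at h2
  have hint := (integrable_condExp (μ := P) (m := atomSigma w x) (f := Set.indicator
    {ω | m ω = n ∧ ∀ i : Fin n, z i ω = k i} fun _ => (1 : ℝ))).congr h1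
  rw [hset, ← ofReal_measureReal, ← h2, ofReal_integral_eq_lintegral_ofReal hint
    (Filter.Eventually.of_forall fun ω => by positivity)]
  refine lintegral_congr_ae ?_
  filter_upwards [hfin] with ω hω
  have hfm : IsFiniteMeasure (atomicMeasure w x ω) := ⟨hω⟩
  rw [exp_mul_pow_div_mul_prod_div measureReal_nonneg, ENNReal.ofReal_mul (by positivity),
    ENNReal.ofReal_prod_of_nonneg fun i _ => NNReal.coe_nonneg _]
  · simp
  · intro h0 i
    rw [measureReal_eq_zero_iff, atomicMeasure_univ] at h0
    have h3 := measure_mono_null (Set.subset_univ {k i}) h0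
    rw [indexMeasure_singleton] at h3
    exact_mod_cast h3

lemma IsCountMixture.measure_eq_lintegral [IsProbabilityMeasure P]
    (hmodel : IsCountMixture P w x m z) (hG : Measurable (atomicMeasure w x))
    (hfin : ∀ᵐ ω ∂P, atomicMeasure w x ω Set.univ < ∞) (n : ℕ) (K : Set (Fin n → ℕ)) :
    P {ω | m ω = n ∧ (fun i : Fin n => z i ω) ∈ K} =
      ∫⁻ ω, ENNReal.ofReal (Real.exp (-(atomicMeasure w x ω).real Set.univ) / n.factorial) *
        Measure.pi (fun _ : Fin n => indexMeasure w ω) K ∂P := by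
  have hset : {ω | m ω = n ∧ (fun i : Fin n => z i ω) ∈ K} =
      ⋃ k ∈ K, {ω | m ω = n ∧ (fun i : Fin n => z i ω) = k} := by
    ext ω
    simp
  have hT : Measurable fun ω => (atomicMeasure w x ω).real Set.univ :=
    ((Measure.measurable_coe MeasurableSet.univ).comp hG).ennreal_toReal
  rw [hset, measure_biUnion (Set.to_countable K)]
  · rw [tsum_subtype K fun k => P {ω | m ω = n ∧ (fun i : Fin n => z i ω) = k}]
    have h1 : ∀ k : Fin n → ℕ, K.indicator
        (fun k => P {ω | m ω = n ∧ (fun i : Fin n => z i ω) = k}) k =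
        ∫⁻ ω, ENNReal.ofReal (Real.exp (-(atomicMeasure w x ω).real Set.univ) / n.factorial) *
          K.indicator (fun k => ∏ i, (w (k i) ω : ℝ≥0∞)) k ∂P := by
      intro k
      by_cases hk : k ∈ K
      · simp only [Set.indicator_of_mem hk, hmodel.measure_singleton hfin]
      · simp [Set.indicator_of_notMem hk]
    rw [tsum_congr h1, ← lintegral_tsum fun k => ?_]
    · refine lintegral_congr_ae ?_
      filter_upwards [hfin] with ω hω
      have := isFiniteMeasure_indexMeasure hω
      rw [pi_indexMeasure_apply, ENNReal.tsum_mul_left]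
    · refine Measurable.aemeasurable (Measurable.mul (by fun_prop) ?_)
      by_cases hk : k ∈ K
      · simp only [Set.indicator_of_mem hk]
        exact Finset.measurable_prod _ fun i _ =>
          (hmodel.measurable_weight (k i)).coe_nnreal_ennreal
      · simp [Set.indicator_of_notMem hk]
  · intro k _ k' _ hne
    exact Set.disjoint_left.2 fun ω hω hω' => hne (hω.2.symm.trans hω'.2)
  · exact fun k _ => hmodel.measurableSet n {k}

lemma IsCountMixture.measurableSet_clusterEvent (hmodel : IsCountMixture P w x m z) {n : ℕ}
    (π : Finpartition (Finset.univ : Finset (Fin n))) : MeasurableSet (clusterEvent m z π) := by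
  rw [clusterEvent_eq]
  exact hmodel.measurableSet n _

/-- The exchangeable cluster probability function. -/
lemma measure_clusterEvent [MeasurableSpace.CountablySeparated S] [IsProbabilityMeasure P]
    {G₀ : Measure S} [IsFiniteMeasure G₀] [NullSingletonClass G₀] {a p : ℝ} (ha : a < 1)
    (hp0 : 0 < p) (hp1 : p < 1)
    (hG : IsGenGammaProcess P (atomicMeasure w x) G₀ a ((1 - p) / p))
    (hmodel : IsCountMixture P w x m z) {n : ℕ}
    (π : Finpartition (Finset.univ : Finset (Fin n))) :
    P.real (clusterEvent m z π) =
      1 / (n.factorial : ℝ) * Real.exp (-(G₀.real Set.univ * clusterRate a p)) *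
        G₀.real Set.univ ^ π.parts.card * p ^ ((n : ℝ) - a * π.parts.card) *
        ∏ B ∈ π.parts, blockWeight a B.card := by
  obtain ⟨f, hf, hf'⟩ := MeasurableSpace.measurable_injection_nat_bool_of_countablySeparated S
  have h1 := hmodel.measure_eq_lintegral hG.measurable hG.finite n {k | tiePartition k = π}
  have hT := hG.measurable_real MeasurableSet.univ
  have hlim : Filter.Tendsto (fun N => ∫⁻ ω,
      ENNReal.ofReal (Real.exp (-(atomicMeasure w x ω).real Set.univ) / n.factorial) *
        ∑ κ : Fin n → Fin N → Bool with tiePartition κ = π,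
          ∏ i, atomicMeasure w x ω (cell f N ⁻¹' {κ i}) ∂P) Filter.atTop
      (nhds (P (clusterEvent m z π))) := by
    rw [clusterEvent_eq, h1]
    -- At each level the integrand is at most `e^{-T} T^n / n!`, hence at most `1`.
    refine tendsto_lintegral_of_dominated_convergence (fun _ => 1) (fun N => ?_) (fun N => ?_)
      (by simp) ?_
    · refine Measurable.mul (by fun_prop) (Finset.measurable_sum _ fun κ _ =>
        Finset.measurable_prod _ fun i _ => hG.measurable_apply
          (measurable_cell hf N (measurableSet_singleton _)))
    · filter_upwards [hG.finite] with ω hω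
      have := isFiniteMeasure_indexMeasure hω
      rw [← pi_indexMeasure_cell w x ω (measurable_cell hf N)]
      refine le_trans ?_ (ofReal_exp_mul_pow_le_one hω.ne n)
      rw [measureReal_def]
      gcongr
      refine (measure_mono (Set.subset_univ _)).trans ?_
      rw [Measure.pi_univ, atomicMeasure_univ]
      simp
    · filter_upwards [hG.finite, hmodel.distinct] with ω hω hd
      have := isFiniteMeasure_indexMeasure hω
      simp only [← pi_indexMeasure_cell w x ω (measurable_cell hf _)]
      exact ENNReal.Tendsto.const_mul (tendsto_pi_indexMeasure_cell w x ω hd hf' π)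
        (Or.inr ENNReal.ofReal_ne_top)
  have hlim2 := ENNReal.Tendsto.const_mul (a := ENNReal.ofReal (1 / n.factorial))
    (hG.tendsto_lintegral_cell ha hp0 hp1 hf hf' π) (Or.inr ENNReal.ofReal_ne_top)
  have heq : ∀ N, ∫⁻ ω,
      ENNReal.ofReal (Real.exp (-(atomicMeasure w x ω).real Set.univ) / n.factorial) *
        ∑ κ : Fin n → Fin N → Bool with tiePartition κ = π,
          ∏ i, atomicMeasure w x ω (cell f N ⁻¹' {κ i}) ∂P =
      ENNReal.ofReal (1 / n.factorial) * ∫⁻ ω,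
        ENNReal.ofReal (Real.exp (-(atomicMeasure w x ω).real Set.univ)) *
        ∑ κ : Fin n → Fin N → Bool with tiePartition κ = π,
          ∏ i, atomicMeasure w x ω (cell f N ⁻¹' {κ i}) ∂P := by
    intro N
    rw [← lintegral_const_mul' _ _ ENNReal.ofReal_ne_top]
    refine lintegral_congr fun ω => ?_
    rw [← mul_assoc, ← ENNReal.ofReal_mul (by positivity), one_div_mul_eq_div]
  simp only [heq] at hlim
  have h2 := tendsto_nhds_unique hlim hlim2
  rw [measureReal_def, h2, ← ENNReal.ofReal_mul (by positivity), card_parts_prod a p _ hp0,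
    ENNReal.toReal_ofReal]
  · ring
  · have : 0 ≤ ∏ B ∈ π.parts, blockWeight a B.card := Finset.prod_nonneg fun B hB =>
      (blockWeight_pos ha (Finset.card_pos.2 (π.nonempty_of_mem_parts hB))).le
    positivity

lemma IsCountMixture.measure_size [IsProbabilityMeasure P]
    (hmodel : IsCountMixture P w x m z) (hG : Measurable (atomicMeasure w x))
    (hfin : ∀ᵐ ω ∂P, atomicMeasure w x ω Set.univ < ∞) (n : ℕ) :
    P {ω | m ω = n} = ∫⁻ ω, ENNReal.ofReal (Real.exp (-(atomicMeasure w x ω).real Set.univ) *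
        (atomicMeasure w x ω).real Set.univ ^ n / n.factorial) ∂P := by
  have h := hmodel.measure_eq_lintegral hG hfin n Set.univ
  simp only [Set.mem_univ, and_true] at h
  rw [h]
  refine lintegral_congr_ae ?_
  filter_upwards [hfin] with ω hω
  have := isFiniteMeasure_indexMeasure hω
  rw [Measure.pi_univ, Finset.prod_const, Finset.card_univ, Fintype.card_fin,
    ← atomicMeasure_univ w x, mul_div_right_comm, ENNReal.ofReal_mul (by positivity),
    ENNReal.ofReal_pow measureReal_nonneg, ofReal_measureReal hω.ne]

end Mixture

/-! ### Sample size and generalized Stirling numbers -/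

lemma sum_blockWeight_eq_genStirling (a : ℝ) (n l : ℕ) :
    ∑ π : Finpartition (Finset.univ : Finset (Fin n)) with π.parts.card = l,
      ∏ B ∈ π.parts, blockWeight a B.card = genStirling a n l := by
  rw [sum_parts_card_eq, genStirling]
  congr 1
  refine Finset.sum_congr rfl fun u _ => Finset.prod_congr rfl fun k _ => ?_
  rw [blockWeight, div_div, mul_comm (Real.Gamma (1 - a))]

lemma sum_pow_mul_blockWeight (a γ : ℝ) {p : ℝ} (hp0 : 0 < p) (n : ℕ) :
    ∑ π : Finpartition (Finset.univ : Finset (Fin n)),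
        γ ^ π.parts.card * p ^ ((n : ℝ) - a * π.parts.card) *
          ∏ B ∈ π.parts, blockWeight a B.card = p ^ n * eppfNormalizer γ a p n := by
  rw [← Finset.sum_fiberwise_of_maps_to (s := Finset.univ) (t := Finset.range (n + 1))
    (g := fun π : Finpartition (Finset.univ : Finset (Fin n)) => π.parts.card), eppfNormalizer,
    Finset.mul_sum]
  · refine Finset.sum_congr rfl fun l _ => ?_
    rw [← sum_blockWeight_eq_genStirling, Finset.mul_sum, Finset.mul_sum]
    refine Finset.sum_congr rfl fun π hπ => ?_
    rw [(Finset.mem_filter.1 hπ).2, sub_eq_add_neg, Real.rpow_add hp0, Real.rpow_natCast]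
    ring
  · intro π _
    have := π.card_parts_le_card
    rw [Finset.card_univ, Fintype.card_fin] at this
    exact Finset.mem_range.2 (Nat.lt_succ_of_le this)

/-! ### The multiset of cluster sizes as a random variable. -/

lemma clusterSizes_of_size_eq {Ω : Type*} {m : Ω → ℕ} {z : ℕ → Ω → ℕ} {n : ℕ} {ω : Ω} (h : m ω = n) :
    clusterSizes m z ω =
      (tiePartition fun i : Fin n => z i ω).parts.val.map Finset.card := by
  subst h
  rfl

lemma clusterSizes_sum {Ω : Type*} (m : Ω → ℕ) (z : ℕ → Ω → ℕ) (ω : Ω) : (clusterSizes m z ω).sum = m ω := by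
  have h := (tiePartition fun i : Fin (m ω) => z i ω).sum_card_parts
  rw [Finset.card_univ, Fintype.card_fin] at h
  exact h

/-- The sizes determine the sample size as their sum, so the event concerns partitions of one fixed
set, although the type of the tie partition varies with `m ω`. -/
lemma clusterSizes_preimage_singleton {Ω : Type*} (m : Ω → ℕ) (z : ℕ → Ω → ℕ) (M : Multiset ℕ) :
    clusterSizes m z ⁻¹' {M} =
    {ω | m ω = M.sum ∧ tiePartition (fun i : Fin M.sum => z i ω) ∈ Finset.univ.filter fun
      π : Finpartition (Finset.univ : Finset (Fin M.sum)) =>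
        π.parts.val.map Finset.card = M} := by
  ext ω
  simp only [Set.mem_preimage, Set.mem_singleton_iff, Finset.mem_filter, Finset.mem_univ,
    true_and, Set.mem_ofPred_eq]
  constructor
  · intro h
    have h1 : m ω = M.sum := by rw [← h, clusterSizes_sum]
    exact ⟨h1, by rw [← clusterSizes_of_size_eq h1, h]⟩
  · rintro ⟨h1, h2⟩
    rw [clusterSizes_of_size_eq h1, h2]

lemma IsCountMixture.measurable_clusterSizes {Ω S : Type*} [MeasurableSpace Ω]
    [MeasurableSpace S] {P : Measure Ω} {w : ℕ → Ω → ℝ≥0} {x : ℕ → Ω → S} {m : Ω → ℕ}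
    {z : ℕ → Ω → ℕ} (hmodel : IsCountMixture P w x m z) :
    Measurable (clusterSizes m z) := by
  refine measurable_to_countable' fun M => ?_
  rw [clusterSizes_preimage_singleton]
  exact hmodel.measurableSet M.sum {k | tiePartition k ∈ Finset.univ.filter fun
      π : Finpartition (Finset.univ : Finset (Fin M.sum)) =>
        π.parts.val.map Finset.card = M}

section Consequences

variable {Ω S : Type*} [MeasurableSpace Ω] [MeasurableSpace S]
  {P : Measure Ω} [IsProbabilityMeasure P] {G₀ : Measure S} {a p : ℝ} {w : ℕ → Ω → ℝ≥0}
  {x : ℕ → Ω → S} {m : Ω → ℕ} {z : ℕ → Ω → ℕ}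

lemma IsCountMixture.sum_measureReal_clusterEvent (hmodel : IsCountMixture P w x m z) {n : ℕ}
    (s : Finset (Finpartition (Finset.univ : Finset (Fin n)))) :
    P.real {ω | m ω = n ∧ tiePartition (fun i : Fin n => z i ω) ∈ s} =
      ∑ π ∈ s, P.real (clusterEvent m z π) := by
  have h : {ω | m ω = n ∧ tiePartition (fun i : Fin n => z i ω) ∈ s} =
      ⋃ π ∈ s, clusterEvent m z π := by
    ext ω
    simp [clusterEvent]
  rw [h, measureReal_biUnion_finset]
  · intro π _ π' _ hne
    exact Set.disjoint_left.2 fun ω hω hω' => hne (hω.2.symm.trans hω'.2)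
  · exact fun π _ => hmodel.measurableSet_clusterEvent π

lemma measureReal_size [MeasurableSpace.CountablySeparated S] [IsFiniteMeasure G₀]
    [NullSingletonClass G₀] (ha : a < 1) (hp0 : 0 < p) (hp1 : p < 1)
    (hG : IsGenGammaProcess P (atomicMeasure w x) G₀ a ((1 - p) / p))
    (hmodel : IsCountMixture P w x m z) (n : ℕ) :
    P.real {ω | m ω = n} = p ^ n / (n.factorial : ℝ) *
      Real.exp (-(G₀.real Set.univ * clusterRate a p)) *
        eppfNormalizer (G₀.real Set.univ) a p n := by
  have h := hmodel.sum_measureReal_clusterEvent (n := n) Finset.univ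
  simp only [Finset.mem_univ, and_true] at h
  rw [h, Finset.sum_congr rfl fun π _ => measure_clusterEvent ha hp0 hp1 hG hmodel π]
  have h2 : ∀ π : Finpartition (Finset.univ : Finset (Fin n)),
      1 / (n.factorial : ℝ) * Real.exp (-(G₀.real Set.univ * clusterRate a p)) *
        G₀.real Set.univ ^ π.parts.card * p ^ ((n : ℝ) - a * π.parts.card) *
        ∏ B ∈ π.parts, blockWeight a B.card =
      1 / (n.factorial : ℝ) * Real.exp (-(G₀.real Set.univ * clusterRate a p)) *
        (G₀.real Set.univ ^ π.parts.card * p ^ ((n : ℝ) - a * π.parts.card) *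
          ∏ B ∈ π.parts, blockWeight a B.card) := fun π => by ring
  rw [Finset.sum_congr rfl fun π _ => h2 π, ← Finset.mul_sum, sum_pow_mul_blockWeight _ _ hp0]
  ring

lemma measureReal_size_eq_blockPoly (hp0 : 0 < p) (hp1 : p < 1)
    (hG : IsGenGammaProcess P (atomicMeasure w x) G₀ a ((1 - p) / p))
    (hmodel : IsCountMixture P w x m z) (n : ℕ) :
    P.real {ω | m ω = n} = 1 / (n.factorial : ℝ) *
      (Real.exp (-(G₀.real Set.univ * clusterRate a p)) *
        blockPoly a p n (G₀.real Set.univ)) := by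
  have h := hmodel.measure_size hG.measurable hG.finite n
  have h1 : ∀ ω, ENNReal.ofReal (Real.exp (-(atomicMeasure w x ω).real Set.univ) *
        (atomicMeasure w x ω).real Set.univ ^ n / n.factorial) =
      ENNReal.ofReal (1 / (n.factorial : ℝ)) * ENNReal.ofReal
        ((atomicMeasure w x ω).real Set.univ ^ n *
          Real.exp (-(atomicMeasure w x ω).real Set.univ)) := by
    intro ω
    rw [← ENNReal.ofReal_mul (by positivity)]
    congr 1
    ring
  rw [lintegral_congr h1, lintegral_const_mul' _ _ ENNReal.ofReal_ne_top,
    hG.lintegral_pow_mul_exp_neg hp0 hp1 MeasurableSet.univ,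
    ← ENNReal.ofReal_mul (by positivity)] at h
  rw [measureReal_def, h, ENNReal.toReal_ofReal (mul_nonneg (by positivity)
    (hG.exp_mul_blockPoly_nonneg hp0 hp1 MeasurableSet.univ n))]

/-- Two evaluations of `P(m = n)`: by summing the ECPF over partitions and by the moments of `G(S)`.
This replaces a combinatorial identification of `genStirling` with the triangle. -/
lemma eppfNormalizer_eq [MeasurableSpace.CountablySeparated S] [IsFiniteMeasure G₀]
    [NullSingletonClass G₀] (ha : a < 1) (hp0 : 0 < p) (hp1 : p < 1)
    (hG : IsGenGammaProcess P (atomicMeasure w x) G₀ a ((1 - p) / p))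
    (hmodel : IsCountMixture P w x m z) (n : ℕ) :
    eppfNormalizer (G₀.real Set.univ) a p n = ∑ l ∈ Finset.range (n + 1),
      G₀.real Set.univ ^ l * p ^ (-(a * l)) * stirlingTriangle a n l := by
  have h := measureReal_size ha hp0 hp1 hG hmodel n
  rw [measureReal_size_eq_blockPoly hp0 hp1 hG hmodel n, blockPoly] at h
  have h1 : ∑ l ∈ Finset.range (n + 1), G₀.real Set.univ ^ l * p ^ ((n : ℝ) - a * l) *
      stirlingTriangle a n l = p ^ n * ∑ l ∈ Finset.range (n + 1),
        G₀.real Set.univ ^ l * p ^ (-(a * l)) * stirlingTriangle a n l := by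
    rw [Finset.mul_sum]
    refine Finset.sum_congr rfl fun l _ => ?_
    rw [sub_eq_add_neg, Real.rpow_add hp0, Real.rpow_natCast]
    ring
  rw [h1] at h
  have h2 := (Real.exp_pos (-(G₀.real Set.univ * clusterRate a p))).ne'
  have h3 : p ^ n ≠ 0 := by positivity
  have h4 : (n.factorial : ℝ) ≠ 0 := by positivity
  field_simp at h
  exact h.symm

lemma measureReal_cond_size_clusterEvent [MeasurableSpace.CountablySeparated S]
    [IsFiniteMeasure G₀] [NullSingletonClass G₀] (ha : a < 1) (hp0 : 0 < p) (hp1 : p < 1)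
    (hG : IsGenGammaProcess P (atomicMeasure w x) G₀ a ((1 - p) / p))
    (hmodel : IsCountMixture P w x m z) {n : ℕ}
    (π : Finpartition (Finset.univ : Finset (Fin n))) :
    (P[|{ω | m ω = n}]).real (clusterEvent m z π) =
      G₀.real Set.univ ^ π.parts.card * p ^ (-(a * π.parts.card)) /
          eppfNormalizer (G₀.real Set.univ) a p n *
        ∏ B ∈ π.parts, blockWeight a B.card := by
  have hms : MeasurableSet {ω | m ω = n} := hmodel.measurable_size (measurableSet_singleton n)
  have hint : {ω | m ω = n} ∩ clusterEvent m z π = clusterEvent m z π :=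
    Set.inter_eq_right.2 fun ω hω => hω.1
  rw [measureReal_def, cond_apply hms, ENNReal.toReal_mul, ENNReal.toReal_inv,
    ← measureReal_def, ← measureReal_def, hint, measureReal_size ha hp0 hp1 hG hmodel,
    measure_clusterEvent ha hp0 hp1 hG hmodel, sub_eq_add_neg, Real.rpow_add hp0,
    Real.rpow_natCast]
  have h2 := (Real.exp_pos (-(G₀.real Set.univ * clusterRate a p))).ne'
  have h3 : p ^ n ≠ 0 := by positivity
  have h4 : (n.factorial : ℝ) ≠ 0 := by positivity
  field_simp

/-! ### Cluster sizes -/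

lemma measure_clusterEvent_labelling [MeasurableSpace.CountablySeparated S] [IsFiniteMeasure G₀]
    [NullSingletonClass G₀] (ha : a < 1) (hp0 : 0 < p) (hp1 : p < 1)
    (hG : IsGenGammaProcess P (atomicMeasure w x) G₀ a ((1 - p) / p))
    (hmodel : IsCountMixture P w x m z) {n l : ℕ} {u : Fin l → ℕ} (hu : ∀ k, 0 < u k)
    {c : Fin n → Fin l} (hc : c ∈ labellings n l u) :
    P.real (clusterEvent m z (tiePartition c)) =
      1 / (n.factorial : ℝ) * Real.exp (-(G₀.real Set.univ * clusterRate a p)) *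
        ∏ k, (G₀.real Set.univ * (p ^ ((u k : ℝ) - a) * blockWeight a (u k))) := by
  have hs := labellings_surjective hu hc
  rw [measure_clusterEvent ha hp0 hp1 hG hmodel, mul_assoc, mul_assoc, ← mul_assoc (_ ^ _),
    ← card_parts_prod a p _ hp0, Finset.prod_coe_sort (tiePartition c).parts fun B =>
      G₀.real Set.univ * (p ^ ((B.card : ℝ) - a) * blockWeight a B.card),
    prod_parts_tiePartition hs fun k =>
      G₀.real Set.univ * (p ^ ((k : ℝ) - a) * blockWeight a k)]
  congr 1
  exact Finset.prod_congr rfl fun k _ => by rw [(Finset.mem_filter.1 hc).2 k]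

/-- The ECPF depends only on the block sizes, so all labellings in the sum contribute equally and
only their number matters. -/
lemma sizesProb_eq_of_mem_labellings [MeasurableSpace.CountablySeparated S] [IsFiniteMeasure G₀]
    [NullSingletonClass G₀] (ha : a < 1) (hp0 : 0 < p) (hp1 : p < 1)
    (hG : IsGenGammaProcess P (atomicMeasure w x) G₀ a ((1 - p) / p))
    (hmodel : IsCountMixture P w x m z) {n l : ℕ} {u : Fin l → ℕ} (hu : ∀ k, 0 < u k)
    {c : Fin n → Fin l} (hc : c ∈ labellings n l u) :
    sizesProb P m z n l u =
      1 / (l.factorial : ℝ) * ((n.factorial : ℝ) / ∏ k, ((u k).factorial : ℝ)) *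
        P.real (clusterEvent m z (tiePartition c)) := by
  rw [sizesProb, Finset.sum_congr rfl fun c' hc' =>
    (measure_clusterEvent_labelling ha hp0 hp1 hG hmodel hu hc').trans
      (measure_clusterEvent_labelling ha hp0 hp1 hG hmodel hu hc).symm,
    Finset.sum_const, nsmul_eq_mul, card_labellings_real (labellings_sum_eq hc), mul_assoc]

lemma sizesProb_eq [MeasurableSpace.CountablySeparated S] [IsFiniteMeasure G₀]
    [NullSingletonClass G₀] (ha : a < 1) (hp0 : 0 < p) (hp1 : p < 1)
    (hG : IsGenGammaProcess P (atomicMeasure w x) G₀ a ((1 - p) / p))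
    (hmodel : IsCountMixture P w x m z) {n l : ℕ} {u : Fin l → ℕ} (hu : ∀ k, 0 < u k) :
    sizesProb P m z n l u =
      if ∑ k, u k = n then
        (poissonMeasure (G₀.real Set.univ * clusterRate a p).toNNReal).real {l} *
          ∏ k, tnbPMFReal a p (u k)
      else 0 := by
  split_ifs with hn
  · obtain ⟨c, hc⟩ : (labellings n l u).Nonempty := by
      rw [← Finset.card_pos, card_labellings hn]
      exact Nat.multinomial_pos _ _
    have hr := clusterRate_pos a hp0 hp1
    rw [sizesProb_eq_of_mem_labellings ha hp0 hp1 hG hmodel hu hc,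
      measure_clusterEvent_labelling ha hp0 hp1 hG hmodel hu hc, poissonMeasure_real_singleton,
      Real.coe_toNNReal _ (mul_nonneg measureReal_nonneg hr.le),
      Finset.prod_congr rfl fun k _ => tnbPMFReal_eq ha hp0 hp1 (hu k), Finset.prod_div_distrib,
      Finset.prod_mul_distrib, Finset.prod_mul_distrib (f := fun k => ((u k).factorial : ℝ)),
      Finset.prod_const, Finset.prod_const, Finset.card_univ, Fintype.card_fin, mul_pow]
    have h1 : ∏ k, ((u k).factorial : ℝ) ≠ 0 :=
      Finset.prod_ne_zero_iff.2 fun k _ => by positivity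
    have h2 := hr.ne'
    field_simp
  · rw [sizesProb, Finset.sum_eq_zero fun c hc => absurd (labellings_sum_eq hc) hn, mul_zero]

end Consequences

/-! ### The law of the cluster sizes -/

/-- Count labelled partitions by partition and by the tuple of class sizes. Since `0 ∉ M`, a
labelling with these sizes is surjective, so no label is wasted. -/
lemma sum_clusterSizes_eq {n l : ℕ} {M : Multiset ℕ} (hM : 0 ∉ M) (hl : M.card = l)
    (h : Finpartition (Finset.univ : Finset (Fin n)) → ℝ) :
    (l.factorial : ℝ) * ∑ π : Finpartition (Finset.univ : Finset (Fin n)) with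
        π.parts.val.map Finset.card = M, h π =
      ∑ u ∈ (Finset.piAntidiag (Finset.univ : Finset (Fin l)) n).filter
        (fun u => (Finset.univ : Finset (Fin l)).val.map u = M),
        ∑ c ∈ labellings n l u, h (tiePartition c) := by
  have h1 := sum_surjective_tiePartition (n := n) (l := l) fun π =>
    if π.parts.val.map Finset.card = M then h π else 0
  rw [← Finset.sum_filter, ← Finset.sum_filter, Finset.filter_filter, Finset.filter_filter] at h1
  have h2 : (Finset.univ.filter fun π : Finpartition (Finset.univ : Finset (Fin n)) =>
      π.parts.card = l ∧ π.parts.val.map Finset.card = M) =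
      Finset.univ.filter fun π => π.parts.val.map Finset.card = M :=
    Finset.filter_congr fun π _ => and_iff_right_of_imp fun hπ => by
      rw [← hl, ← hπ, Multiset.card_map]
      rfl
  rw [h2] at h1
  rw [← h1, ← Finset.sum_fiberwise_of_maps_to
    (g := fun (c : Fin n → Fin l) k => (Finset.univ.filter fun i => c i = k).card)
    (t := (Finset.piAntidiag (Finset.univ : Finset (Fin l)) n).filter
        (fun u => (Finset.univ : Finset (Fin l)).val.map u = M))]
  · refine Finset.sum_congr rfl fun u hu => ?_
    obtain ⟨hu1, hu2⟩ := Finset.mem_filter.1 hu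
    have hpos : ∀ k, 0 < u k := fun k => Nat.pos_of_ne_zero fun h0 => hM (by
      rw [← hu2, ← h0]
      exact Multiset.mem_map_of_mem u (Finset.mem_univ k))
    refine Finset.sum_congr ?_ fun _ _ => rfl
    ext c
    rw [Finset.mem_filter, Finset.mem_filter]
    constructor
    · rintro ⟨-, rfl⟩
      simp [labellings]
    · intro hc
      have hs := labellings_surjective hpos hc
      have hcu : (fun k => (Finset.univ.filter fun i => c i = k).card) = u :=
        funext (Finset.mem_filter.1 hc).2
      exact ⟨⟨Finset.mem_univ c, hs, by rw [map_card_parts_tiePartition hs, hcu, hu2]⟩, hcu⟩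
  · intro c hc
    obtain ⟨hs, hc2⟩ := (Finset.mem_filter.1 hc).2
    rw [map_card_parts_tiePartition hs] at hc2
    have hm : c ∈ labellings n l fun k => (Finset.univ.filter fun i => c i = k).card := by
      simp [labellings]
    rw [Finset.mem_filter, Finset.mem_piAntidiag]
    exact ⟨⟨labellings_sum_eq hm, fun k _ => Finset.mem_univ k⟩, hc2⟩

instance instDiscreteMeasurableSpaceMultisetNat : DiscreteMeasurableSpace (Multiset ℕ) :=
  ⟨fun _ => trivial⟩

lemma compoundSizesLaw_apply (r : ℝ≥0) (τ : Measure ℕ) (A : Set (Multiset ℕ)) :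
    compoundSizesLaw r τ A = ∑' l : ℕ, poissonMeasure r {l} *
      (Measure.pi fun _ : Fin l => τ) {u | (Finset.univ : Finset (Fin l)).val.map u ∈ A} := by
  rw [compoundSizesLaw, Measure.bind_apply .of_discrete Measurable.of_discrete.aemeasurable,
    lintegral_countable']
  refine tsum_congr fun l => ?_
  rw [Measure.map_apply .of_discrete .of_discrete, mul_comm]
  rfl

lemma compoundSizesLaw_singleton (r : ℝ≥0) (τ : Measure ℕ) [IsProbabilityMeasure τ]
    (M : Multiset ℕ) : compoundSizesLaw r τ {M} = poissonMeasure r {M.card} *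
      ∑ u ∈ (Finset.piAntidiag (Finset.univ : Finset (Fin M.card)) M.sum).filter
        (fun u => (Finset.univ : Finset (Fin M.card)).val.map u = M), ∏ k, τ {u k} := by
  rw [compoundSizesLaw_apply, tsum_eq_single M.card]
  · congr 1
    simp only [← Measure.pi_singleton]
    rw [sum_measure_singleton]
    congr 1
    ext u
    simp only [Finset.coe_filter, Finset.mem_piAntidiag, Set.mem_ofPred_eq,
      Set.mem_singleton_iff]
    refine ⟨fun h => ⟨⟨?_, fun k _ => Finset.mem_univ k⟩, h⟩, fun h => h.2⟩
    conv_rhs => rw [← h]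
    rfl
  · intro l hl
    have : {u : Fin l → ℕ | (Finset.univ : Finset (Fin l)).val.map u ∈ ({M} : Set (Multiset ℕ))} =
        ∅ := by
      ext u
      simp only [Set.mem_singleton_iff, Set.mem_ofPred_eq, Set.mem_empty_iff_false, iff_false]
      rintro rfl
      exact hl (by simp)
    rw [this, measure_empty, mul_zero]

lemma compoundSizesLaw_map_card (r : ℝ≥0) (τ : Measure ℕ) [IsProbabilityMeasure τ] :
    (compoundSizesLaw r τ).map Multiset.card = poissonMeasure r := by
  refine Measure.ext_of_singleton fun l => ?_
  rw [Measure.map_apply .of_discrete .of_discrete, compoundSizesLaw_apply, tsum_eq_single l]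
  · have : {u : Fin l → ℕ | (Finset.univ : Finset (Fin l)).val.map u ∈
        Multiset.card ⁻¹' ({l} : Set ℕ)} = Set.univ := by
      ext u
      simp
    rw [this, measure_univ, mul_one]
  · intro k hk
    have : {u : Fin k → ℕ | (Finset.univ : Finset (Fin k)).val.map u ∈
        Multiset.card ⁻¹' ({l} : Set ℕ)} = ∅ := by
      ext u
      simp [hk]
    rw [this, measure_empty, mul_zero]

section Laws

variable {Ω S : Type*} [MeasurableSpace Ω] [MeasurableSpace S]
  {P : Measure Ω} [IsProbabilityMeasure P] {G₀ : Measure S} {a p : ℝ} {w : ℕ → Ω → ℝ≥0}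
  {x : ℕ → Ω → S} {m : Ω → ℕ} {z : ℕ → Ω → ℕ}

lemma hasLaw_clusterSizes [MeasurableSpace.CountablySeparated S] [IsFiniteMeasure G₀]
    [NullSingletonClass G₀] (ha : a < 1) (hp0 : 0 < p) (hp1 : p < 1)
    (hG : IsGenGammaProcess P (atomicMeasure w x) G₀ a ((1 - p) / p))
    (hmodel : IsCountMixture P w x m z) :
    HasLaw (clusterSizes m z)
      (compoundSizesLaw (G₀.real Set.univ * clusterRate a p).toNNReal (tnbMeasure a p)) P := by
  have := isProbabilityMeasure_tnbMeasure ha hp0 hp1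
  have hmeas := hmodel.measurable_clusterSizes
  refine ⟨hmeas.aemeasurable, Measure.ext_of_singleton fun M => ?_⟩
  rw [Measure.map_apply hmeas .of_discrete, compoundSizesLaw_singleton, ← ofReal_measureReal,
    clusterSizes_preimage_singleton, hmodel.sum_measureReal_clusterEvent]
  simp only [tnbMeasure_singleton]
  simp only [← ENNReal.ofReal_prod_of_nonneg fun k _ => tnbPMFReal_nonneg ha hp0 hp1 _]
  rw [← ENNReal.ofReal_sum_of_nonneg fun u _ => Finset.prod_nonneg fun k _ =>
    tnbPMFReal_nonneg ha hp0 hp1 _, ← ofReal_measureReal, ← ENNReal.ofReal_mul measureReal_nonneg]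
  congr 1
  -- Both sides vanish when `0 ∈ M`: blocks are nonempty and the TNB law does not charge `0`.
  by_cases hM : 0 ∈ M
  · rw [Finset.sum_eq_zero, Finset.sum_eq_zero, mul_zero]
    · intro u hu
      rw [← (Finset.mem_filter.1 hu).2] at hM
      obtain ⟨k, -, hk⟩ := Multiset.mem_map.1 hM
      rw [Finset.prod_eq_zero (Finset.mem_univ k)]
      rw [hk]
      simp [tnbPMFReal]
    · intro π hπ
      rw [← (Finset.mem_filter.1 hπ).2] at hM
      obtain ⟨B, hB, hB0⟩ := Multiset.mem_map.1 hM
      exact absurd hB0 (Finset.card_pos.2 (π.nonempty_of_mem_parts hB)).ne'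
  · have h1 := sum_clusterSizes_eq (n := M.sum) hM rfl fun π => P.real (clusterEvent m z π)
    rw [← eq_inv_mul_iff_mul_eq₀ (by positivity)] at h1
    rw [h1, Finset.mul_sum, Finset.mul_sum]
    refine Finset.sum_congr rfl fun u hu => ?_
    obtain ⟨hu1, hu2⟩ := Finset.mem_filter.1 hu
    have hpos : ∀ k, 0 < u k := fun k => Nat.pos_of_ne_zero fun h0 => hM (by
      rw [← hu2, ← h0]
      exact Multiset.mem_map_of_mem u (Finset.mem_univ k))
    have h2 := sizesProb_eq (n := M.sum) ha hp0 hp1 hG hmodel hpos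
    rw [if_pos (Finset.mem_piAntidiag.1 hu1).1, sizesProb] at h2
    rw [← h2, one_div]

lemma hasLaw_numClusters [MeasurableSpace.CountablySeparated S] [IsFiniteMeasure G₀]
    [NullSingletonClass G₀] (ha : a < 1) (hp0 : 0 < p) (hp1 : p < 1)
    (hG : IsGenGammaProcess P (atomicMeasure w x) G₀ a ((1 - p) / p))
    (hmodel : IsCountMixture P w x m z) :
    HasLaw (numClusters m z)
      (poissonMeasure (G₀.real Set.univ * clusterRate a p).toNNReal) P := by
  have := isProbabilityMeasure_tnbMeasure ha hp0 hp1
  have h : numClusters m z = Multiset.card ∘ clusterSizes m z := by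
    funext ω
    simp [numClusters, clusterSizes]
  rw [h]
  exact HasLaw.comp ⟨Measurable.of_discrete.aemeasurable, compoundSizesLaw_map_card _ _⟩
    (hasLaw_clusterSizes ha hp0 hp1 hG hmodel)

/-! ### The law of the sample size -/

lemma measurable_poissonMeasure_toNNReal :
    Measurable fun t : ℝ => poissonMeasure t.toNNReal := by
  refine Measure.measurable_of_measurable_coe _ fun A _ => ?_
  simp only [← Measure.tsum_indicator_apply_singleton _ A .of_discrete,
    poissonMeasure_singleton]
  refine Measurable.tsum fun n => ?_
  by_cases hn : n ∈ A
  · simp only [Set.indicator_of_mem hn]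
    fun_prop
  · simp [Set.indicator_of_notMem hn]

lemma isGenNegBinomial_map_size (hG : IsGenGammaProcess P (atomicMeasure w x) G₀ a ((1 - p) / p))
    (hmodel : IsCountMixture P w x m z) :
    IsGenNegBinomial (P.map m) (G₀.real Set.univ) a p := by
  have h := hG.law Set.univ MeasurableSet.univ
  rw [inv_div] at h
  refine ⟨_, h, Measure.ext_of_singleton fun n => ?_⟩
  rw [Measure.map_apply hmodel.measurable_size .of_discrete,
    Measure.bind_apply .of_discrete measurable_poissonMeasure_toNNReal.aemeasurable,
    lintegral_map _ (hG.measurable_real MeasurableSet.univ)]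
  · refine (hmodel.measure_size hG.measurable hG.finite n).trans (lintegral_congr fun ω => ?_)
    rw [poissonMeasure_singleton, Real.coe_toNNReal _ measureReal_nonneg]
  · exact (Measure.measurable_coe .of_discrete).comp measurable_poissonMeasure_toNNReal

/-- Given the total mass `T` the generating function is that of a Poisson variable, `e^{-(1-t)T}`,
and `1 - t ≥ 0` is an admissible Laplace argument. -/
lemma integral_pow_size (hp0 : 0 < p) (hp1 : p < 1)
    (hG : IsGenGammaProcess P (atomicMeasure w x) G₀ a ((1 - p) / p))
    (hmodel : IsCountMixture P w x m z) {t : ℝ} (ht : |t| ≤ 1) :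
    ∫ ω, t ^ m ω ∂P = Real.exp (-(G₀.real Set.univ * gnbExponent a p t)) := by
  have hT := hG.measurable_real MeasurableSet.univ
  have hint : ∀ n : ℕ, Integrable (fun ω => Real.exp (-(atomicMeasure w x ω).real Set.univ) *
        (atomicMeasure w x ω).real Set.univ ^ n / n.factorial) P := by
    intro n
    refine (integrable_const (1 : ℝ)).mono' (by fun_prop) (Filter.Eventually.of_forall fun ω => ?_)
    rw [Real.norm_of_nonneg (by positivity), mul_div_assoc]
    calc _ ≤ Real.exp (-(atomicMeasure w x ω).real Set.univ) *
          Real.exp ((atomicMeasure w x ω).real Set.univ) := by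
          gcongr
          exact Real.pow_div_factorial_le_exp _ measureReal_nonneg n
      _ = 1 := by rw [← Real.exp_add]; simp
  have hsize : ∀ n : ℕ, P.real {ω | m ω = n} =
      ∫ ω, Real.exp (-(atomicMeasure w x ω).real Set.univ) *
        (atomicMeasure w x ω).real Set.univ ^ n / n.factorial ∂P := by
    intro n
    rw [measureReal_def, hmodel.measure_size hG.measurable hG.finite n,
      ← ofReal_integral_eq_lintegral_ofReal (hint n)
        (Filter.Eventually.of_forall fun ω => by positivity),
      ENNReal.toReal_ofReal (integral_nonneg fun ω => by positivity)]
  have hprob : IsProbabilityMeasure (P.map m) :=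
    Measure.isProbabilityMeasure_map hmodel.measurable_size.aemeasurable
  have hmap : ∀ n : ℕ, (P.map m).real {n} = P.real {ω | m ω = n} := fun n =>
    map_measureReal_apply hmodel.measurable_size (measurableSet_singleton n)
  have hsummable : Summable fun n : ℕ => P.real {ω | m ω = n} := by
    simp only [← hmap]
    refine ENNReal.summable_toReal ?_
    have h := Measure.tsum_indicator_apply_singleton (P.map m) Set.univ .univ
    simp only [Set.indicator_univ] at h
    rw [h]
    exact measure_ne_top _ _
  have h1 : ∫ ω, t ^ m ω ∂P = ∑' n : ℕ, ∫ ω, t ^ n *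
      (Real.exp (-(atomicMeasure w x ω).real Set.univ) *
        (atomicMeasure w x ω).real Set.univ ^ n / n.factorial) ∂P := by
    rw [← integral_map (f := fun n : ℕ => t ^ n) hmodel.measurable_size.aemeasurable (by fun_prop),
      integral_countable]
    · refine tsum_congr fun n => ?_
      rw [integral_const_mul, ← hsize, hmap, smul_eq_mul, mul_comm]
    · refine (integrable_const (1 : ℝ)).mono' (by fun_prop)
        (Filter.Eventually.of_forall fun n => ?_)
      rw [norm_pow]
      exact pow_le_one₀ (norm_nonneg t) ht
  -- Sum and expectation may be exchanged because, for `|t| ≤ 1`, the norms integrate to at most the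
  -- summable `P(m = n)`.
  have h2 := hasSum_integral_of_summable_integral_norm (μ := P) (F := fun (n : ℕ) ω => t ^ n *
      (Real.exp (-(atomicMeasure w x ω).real Set.univ) *
        (atomicMeasure w x ω).real Set.univ ^ n / n.factorial))
    (fun n => (hint n).const_mul _) (by
      refine Summable.of_nonneg_of_le (fun n => integral_nonneg fun ω => norm_nonneg _)
        (fun n => ?_) hsummable
      rw [hsize]
      refine integral_mono ((hint n).const_mul _).norm (hint n) fun ω => ?_
      have h0 : 0 ≤ Real.exp (-(atomicMeasure w x ω).real Set.univ) *
        (atomicMeasure w x ω).real Set.univ ^ n / n.factorial := by positivity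
      change ‖_ * _‖ ≤ _
      rw [norm_mul, norm_pow, Real.norm_of_nonneg h0]
      exact mul_le_of_le_one_left h0 (pow_le_one₀ (norm_nonneg t) ht))
  rw [h1, h2.tsum_eq]
  have ht1 : 0 ≤ 1 - t := by linarith [(abs_le.1 ht).2]
  have h3 : ∀ ω, ∑' n : ℕ, t ^ n * (Real.exp (-(atomicMeasure w x ω).real Set.univ) *
        (atomicMeasure w x ω).real Set.univ ^ n / n.factorial) =
      Real.exp (-((1 - t) * (atomicMeasure w x ω).real Set.univ)) := by
    intro ω
    set T := (atomicMeasure w x ω).real Set.univ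
    have h4 := (NormedSpace.expSeries_div_hasSum_exp (𝔸 := ℝ) (t * T)).mul_left (Real.exp (-T))
    rw [← Real.exp_eq_exp_ℝ, ← Real.exp_add] at h4
    rw [show -((1 - t) * T) = -T + t * T by ring, ← h4.tsum_eq]
    refine tsum_congr fun n => ?_
    rw [mul_pow]
    ring
  simp only [h3]
  have h5 := (hG.law Set.univ MeasurableSet.univ).laplace (1 - t) ht1
  rw [integral_map hT.aemeasurable (by fun_prop), inv_inv,
    genGammaExponent_eq_gnbExponent a hp0 hp1 (by linarith)] at h5
  exact h5

end Laws

theorem mainTheorem7 {Ω S : Type*} [MeasurableSpace Ω] [MeasurableSpace S]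
    [MeasurableSpace.CountablySeparated S]
    (P : Measure Ω) [IsProbabilityMeasure P]
    (G₀ : Measure S) [IsFiniteMeasure G₀] [NullSingletonClass G₀] (hG₀ : G₀ ≠ 0)
    (γ : ℝ) (hγ : γ = G₀.real Set.univ)
    (a p : ℝ) (ha : a < 1) (hp0 : 0 < p) (hp1 : p < 1)
    (w : ℕ → Ω → ℝ≥0) (x : ℕ → Ω → S) (m : Ω → ℕ) (z : ℕ → Ω → ℕ)
    (hG : IsGenGammaProcess P (atomicMeasure w x) G₀ a ((1 - p) / p))
    (hmodel : IsCountMixture P w x m z) :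
    -- exchangeable cluster probability function
    (∀ (n : ℕ) (π : Finpartition (Finset.univ : Finset (Fin n))),
      P.real (clusterEvent m z π) =
        1 / (n.factorial : ℝ) * Real.exp (-(γ * clusterRate a p)) *
          γ ^ π.parts.card * p ^ ((n : ℝ) - a * π.parts.card) *
          ∏ B ∈ π.parts, Real.Gamma ((B.card : ℝ) - a) / Real.Gamma (1 - a)) ∧
    -- exchangeable partition probability function
    (∀ (n : ℕ) (π : Finpartition (Finset.univ : Finset (Fin n))),
      (P[|{ω | m ω = n}]).real (clusterEvent m z π) =
        γ ^ π.parts.card * p ^ (-(a * π.parts.card)) / eppfNormalizer γ a p n *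
          ∏ B ∈ π.parts, Real.Gamma ((B.card : ℝ) - a) / Real.Gamma (1 - a)) ∧
    -- series form of its denominator, `Γ(n - ak) / Γ(-ak)` being the rising factorial of `-ak`
    (a ≠ 0 → ∀ n : ℕ, HasSum
      (fun k : ℕ => Real.exp (γ / (a * p ^ a)) *
        (1 / (k.factorial : ℝ) * (-(γ / (a * p ^ a))) ^ k *
          (ascPochhammer ℝ n).eval (-(a * k))))
      (eppfNormalizer γ a p n)) ∧
    -- probability of a collection of unordered cluster sizes
    (∀ (n l : ℕ) (u : Fin l → ℕ), (∀ k, 0 < u k) →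
      (∀ c ∈ labellings n l u,
        sizesProb P m z n l u =
          1 / (l.factorial : ℝ) * ((n.factorial : ℝ) / ∏ k, ((u k).factorial : ℝ)) *
            P.real (clusterEvent m z (tiePartition c))) ∧
      sizesProb P m z n l u =
        if ∑ k, u k = n then
          (poissonMeasure (γ * clusterRate a p).toNNReal).real {l} * ∏ k, tnbPMFReal a p (u k)
        else 0) ∧
    -- Poisson number of clusters with i.i.d. truncated negative binomial sizes
    IsProbabilityMeasure (tnbMeasure a p) ∧
    HasLaw (clusterSizes m z)
      (compoundSizesLaw (γ * clusterRate a p).toNNReal (tnbMeasure a p)) P ∧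
    HasLaw (numClusters m z) (poissonMeasure (γ * clusterRate a p).toNNReal) P ∧
    -- generalized negative binomial sample size
    IsGenNegBinomial (P.map m) γ a p ∧
    (∀ t : ℝ, |t| ≤ 1 → ∫ ω, t ^ m ω ∂P = Real.exp (-(γ * gnbExponent a p t))) ∧
    (∀ n : ℕ, P.real {ω | m ω = n} =
      p ^ n / (n.factorial : ℝ) * Real.exp (-(γ * clusterRate a p)) * eppfNormalizer γ a p n) := by
  subst hγ
  refine ⟨fun n π => ?_, fun n π => ?_, fun ha0 n => ?_, fun n l u hu => ⟨fun c hc => ?_, ?_⟩,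
    isProbabilityMeasure_tnbMeasure ha hp0 hp1, hasLaw_clusterSizes ha hp0 hp1 hG hmodel,
    hasLaw_numClusters ha hp0 hp1 hG hmodel, isGenNegBinomial_map_size hG hmodel,
    fun t ht => integral_pow_size hp0 hp1 hG hmodel ht,
    measureReal_size ha hp0 hp1 hG hmodel⟩
  · exact measure_clusterEvent ha hp0 hp1 hG hmodel π
  · exact measureReal_cond_size_clusterEvent ha hp0 hp1 hG hmodel π
  · rw [eppfNormalizer_eq ha hp0 hp1 hG hmodel]
    exact hasSum_ascPochhammer ha0 hp0 _ n
  · exact sizesProb_eq_of_mem_labellings ha hp0 hp1 hG hmodel hu hc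
  · exact sizesProb_eq ha hp0 hp1 hG hmodel hu
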